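/- Let $\Lambda$ be an artin algebra (an algebra over a commutative artinian ring $R$, finitely generated as an $R$-module), let $P$ be a finitely generated projective left $\Lambda$-module, $\Gamma=\mathrm{End}_\Lambda(P)^{op}$, let $r$ be the Jacobson radical of $\Lambda$ and $I$ the injective envelope of $P/rP$. Let $\mathrm{mod}$ denote finitely generated left modules, let $\mathrm{add}\,M$ consist of the direct summands of finite direct sums of copies of $M$, and let $\mathbb I_\infty$ consist of the $Y$ in $\mathrm{mod}\,\Lambda$ having an injective coresolution $0\to Y\to J_0\to J_1\to\cdots$ with all $J_n$ in $\mathrm{add}\,I$. For an artin algebra $A$ and $M$ in $\mathrm{mod}\,A$: * For $d\ge 0$, a pair $(X_1,X_2)$ of modules in $\mathrm{add}\,M$ is a *$d$-injective division* of $M$ if $\mathrm{add}\,X_1\cap\mathrm{add}\,X_2=0$, $\mathrm{Ext}^d_A(-,X_1)\not\simeq\mathrm{Ext}^d_A(-,X_2)$ and $\mathrm{Ext}^{d+1}_A(-,X_1)\simeq\mathrm{Ext}^{d+1}_A(-,X_2)$ as functors on $\mathrm{mod}\,A$. * Let $\Omega^{-1}(M)$ be the cosyzygy of $M$, i.e.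 the cokernel of an injective envelope of $M$, and $\Omega^{-n}(M)$ its $n$-fold iterate. Let $K_0$ be the abelian group generated by symbols $[M]$, $M$ in $\mathrm{mod}\,A$, with relations $[C]=[B]+[B']$ if $C\simeq B\oplus B'$ and $[J]=0$ if $J$ is injective. Let $\Omega^{-1}:K_0\to K_0$ be the homomorphism with $[M]\mapsto[\Omega^{-1}(M)]$, and let $\langle\mathrm{add}\,M\rangle\subseteq K_0$ be the subgroup generated by the classes of the indecomposable direct summands of $M$. Then $\phi_r^A(M)$ is the smallest $n\ge 0$ such that $\Omega^{-1}:\Omega^{-s}\langle\mathrm{add}\,M\rangle\to\Omega^{-(s+1)}\langle\mathrm{add}\,M\rangle$ is an isomorphism for all $s\ge n$, and $$\psi_r^A(M)=\phi_r^A(M)+\sup\{\mathrm{id}\,X : X \text{ is a direct summand of } \Omega^{-\phi_r^A(M)}(M),\ \mathrm{id}\,X<\infty\},$$ where $\mathrm{id}$ is the injective dimension and the zero summand contributes $0$. Then for every $Y\in\mathbb I_\infty$: (a) for every $d\ge 0$, there exists a $d$-injective division of the $\Lambda$-module $Y$ if and only if there exists a $d$-injective division of the $\Gamma$-module $\mathrm{Hom}_\Lambda(P,Y)$;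 (b) $\phi_r^\Lambda(Y)=\phi_r^\Gamma(\mathrm{Hom}_\Lambda(P,Y))$; (c) $\psi_r^\Lambda(Y)=\psi_r^\Gamma(\mathrm{Hom}_\Lambda(P,Y))$. -/

import Mathlib

open CategoryTheory

universe u

noncomputable section

namespace IgusaTodorov

section General

variable {Λ : Type u} [Ring Λ]

/-! ### Direct summands and `add` -/

/-- `X` is (isomorphic to) a direct summand of `M`. -/
def IsSummand (X M : ModuleCat.{u} Λ) : Prop :=
  Nonempty (Retract X M)

/-- `X` belongs to `add M`: it is a direct summand of a finite direct sum of copies of `M`. -/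
def InAdd (X M : ModuleCat.{u} Λ) : Prop :=
  ∃ n : ℕ, IsSummand X (ModuleCat.of Λ (Fin n → M))

/-- `X` is nonzero and is not a direct sum of two nonzero modules. -/
def IsIndecomposable (X : ModuleCat.{u} Λ) : Prop :=
  Nontrivial X ∧ ∀ A B : ModuleCat.{u} Λ,
    Nonempty (X ≃ₗ[Λ] (A × B)) → Subsingleton A ∨ Subsingleton B

/-! ### Injective envelopes and cosyzygies -/

/-- `f : M → E` is an injective envelope: `E` is injective, `f` is injective, and `E` is an
essential extension of the image of `f`. -/
structure IsInjectiveEnvelope {M E : ModuleCat.{u} Λ} (f : M →ₗ[Λ] E) : Prop where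
  injective_module : Module.Injective Λ E
  injective : Function.Injective f
  essential : ∀ S : Submodule Λ E, S ⊓ LinearMap.range f = ⊥ → S = ⊥

/-- `N` is (isomorphic to) the cosyzygy `Ω⁻¹(M)`, the cokernel of an injective envelope of `M`. -/
def IsCosyzygy (M N : ModuleCat.{u} Λ) : Prop :=
  ∃ (E : ModuleCat.{u} Λ) (f : M →ₗ[Λ] E) (g : E →ₗ[Λ] N),
    IsInjectiveEnvelope f ∧ Function.Exact f g ∧ Function.Surjective g

/-- `N` is (isomorphic to) the `n`-th cosyzygy `Ω⁻ⁿ(M)`. -/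
def IsNthCosyzygy : ℕ → ModuleCat.{u} Λ → ModuleCat.{u} Λ → Prop
  | 0, M, N => Nonempty (M ≅ N)
  | n + 1, M, N => ∃ K : ModuleCat.{u} Λ, IsNthCosyzygy n M K ∧ IsCosyzygy K N

/-! ### The subcategory `𝕀_∞` -/

/-- `Y` has an injective coresolution `0 → Y → J₀ → J₁ → ⋯` with all `Jₙ` in `add I`. -/
def HasAddCoresolution (I Y : ModuleCat.{u} Λ) : Prop :=
  ∃ (J : ℕ → ModuleCat.{u} Λ) (ε : Y →ₗ[Λ] J 0) (d : ∀ n, J n →ₗ[Λ] J (n + 1)),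
    (∀ n, Module.Injective Λ (J n)) ∧ (∀ n, InAdd (J n) I) ∧
    Function.Injective ε ∧ Function.Exact ε (d 0) ∧ ∀ n, Function.Exact (d n) (d (n + 1))

/-- The top `P / rP` of `P`, where `r` is the Jacobson radical of `Λ`. -/
abbrev top (P : ModuleCat.{u} Λ) : ModuleCat.{u} Λ :=
  ModuleCat.of Λ (P ⧸ (Ring.jacobson Λ • (⊤ : Submodule Λ P)))

/-- `Y` lies in `𝕀_∞` (relative to `P`): with `I` the injective envelope of `P / rP`, the module
`Y` has an injective coresolution in `add I`. -/
def MemIInfty (P Y : ModuleCat.{u} Λ) : Prop :=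
  ∃ (I : ModuleCat.{u} Λ) (ι : top P →ₗ[Λ] I), IsInjectiveEnvelope ι ∧ HasAddCoresolution I Y

/-! ### Injective divisions -/

/-- The contravariant functor `Ext^d_Λ(-, X)` on the category of finitely generated modules. -/
def extInto (d : ℕ) (X : ModuleCat.{u} Λ) : (FGModuleCat.{u} Λ)ᵒᵖ ⥤ AddCommGrpCat.{u} :=
  (forget₂ (FGModuleCat.{u} Λ) (ModuleCat.{u} Λ)).op ⋙ (Abelian.extFunctor d).flip.obj X

/-- The pair `(X, Y)` is a `d`-injective division of `M`. -/
structure IsInjectiveDivision (d : ℕ) (M X Y : ModuleCat.{u} Λ) : Prop where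
  left_mem : InAdd X M
  right_mem : InAdd Y M
  add_inter : ∀ Z : ModuleCat.{u} Λ, InAdd Z X → InAdd Z Y → Subsingleton Z
  not_iso : IsEmpty (extInto d X ≅ extInto d Y)
  iso : Nonempty (extInto (d + 1) X ≅ extInto (d + 1) Y)

/-! ### The Igusa-Todorov functions `φ_r` and `ψ_r` -/

variable (Λ) in
/-- The relations of `K₀`: `[C] = [A] + [B]` if `C ≃ A ⊕ B`, and `[I] = 0` if `I` is injective. -/
def k0Relations : AddSubgroup (FreeAbelianGroup (FGModuleCat.{u} Λ)) :=
  AddSubgroup.closure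
    ({x | ∃ A B C : FGModuleCat.{u} Λ, Nonempty (C ≃ₗ[Λ] (A × B)) ∧
        x = FreeAbelianGroup.of C - (FreeAbelianGroup.of A + FreeAbelianGroup.of B)} ∪
      {x | ∃ I : FGModuleCat.{u} Λ, Module.Injective Λ I ∧ x = FreeAbelianGroup.of I})

variable (Λ) in
/-- The abelian group `K₀` of finitely generated modules, modulo direct sums and injectives. -/
abbrev K0 : Type (u + 1) :=
  FreeAbelianGroup (FGModuleCat.{u} Λ) ⧸ k0Relations Λ

/-- The class `[M]` in `K₀`. -/
def K0.mk (M : FGModuleCat.{u} Λ) : K0 Λ :=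
  QuotientAddGroup.mk (FreeAbelianGroup.of M)

open Classical in
variable (Λ) in
/-- The endomorphism of `K₀` induced by the cosyzygy, `[M] ↦ [Ω⁻¹(M)]`. Over an artin algebra
injective envelopes of finitely generated modules exist, are finitely generated, unique up to
isomorphism and compatible with finite direct sums, so that there is exactly one such
endomorphism; over a ring that has none, the value is `0`. -/
def cosyzygyHom : K0 Λ →+ K0 Λ :=
  if h : ∃ f : K0 Λ →+ K0 Λ, ∀ M N : FGModuleCat.{u} Λ,
      IsCosyzygy M.obj N.obj → f (K0.mk M) = K0.mk N
  then h.choose else 0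

/-- The subgroup `⟨add M⟩` of `K₀` generated by the indecomposable direct summands of `M`. -/
def addSubgroup (M : ModuleCat.{u} Λ) : AddSubgroup (K0 Λ) :=
  AddSubgroup.closure
    {x | ∃ X : FGModuleCat.{u} Λ, IsIndecomposable X.obj ∧ IsSummand X.obj M ∧ x = K0.mk X}

/-- The image of `⟨add M⟩` under the `s`-th power of the endomorphism of `K₀` induced by the
cosyzygy. -/
def cosyzygySubgroup (M : ModuleCat.{u} Λ) : ℕ → AddSubgroup (K0 Λ)
  | 0 => addSubgroup M
  | s + 1 => (cosyzygySubgroup M s).map (cosyzygyHom Λ)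

/-- `φ_r(M)`: the smallest `n` such that for all `s ≥ n` the endomorphism induced by the cosyzygy
maps its `s`-th image of `⟨add M⟩` isomorphically onto the `(s + 1)`-st one. -/
def phiR (M : ModuleCat.{u} Λ) : ℕ :=
  sInf {n | ∀ s, n ≤ s →
    Set.BijOn (cosyzygyHom Λ) (cosyzygySubgroup M s) (cosyzygySubgroup M (s + 1))}

/-- `ψ_r(M) = φ_r(M) + sup {id X}`, where `X` runs through the direct summands of finite injective
dimension of the `φ_r(M)`-th cosyzygy of `M`. The supremum is taken in `ℕ∞`. The zero summand,
whose `injectiveDimension` is `⊥`, contributes nothing. -/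
def psiR (M : ModuleCat.{u} Λ) : ℕ∞ :=
  (phiR M : ℕ∞) + sSup {k : ℕ∞ | ∃ (m : ℕ) (N X : ModuleCat.{u} Λ),
    IsNthCosyzygy (phiR M) M N ∧ IsSummand X N ∧ injectiveDimension X = m ∧ k = m}

end General

section HomFunctor

variable {Λ : Type u} [Ring Λ]

/-- `Γ = End_Λ(P)ᵒᵖ`. -/
abbrev EndOp (P : ModuleCat.{u} Λ) : Type u := (End P)ᵐᵒᵖ

/-- The left `Γ`-module `Hom_Λ(P, Y)`, on which `Γ = End_Λ(P)ᵒᵖ` acts by precomposition. -/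
abbrev homP (P Y : ModuleCat.{u} Λ) : ModuleCat.{u} (EndOp P) :=
  (preadditiveCoyonedaObj P).obj Y

end HomFunctor

end IgusaTodorov

end

/-! Write F for the functor `Hom_Λ(P, -)`. The trace ideal of P, generated by the values of maps P →
Λ, kills no nonzero element of the envelope I of P/rP, hence none of any module in add I; this is
the property `Detects`. It makes F faithful on maps into such modules. Moreover, if J is detected
and injective, every Γ-linear map from a submodule of F X to F J is induced by a map X → J
(`Detects.exists_map_comp_eq`). From this, F J is injective, F preserves detected injective
envelopes, and F is fully faithful on maps into the kernel of a map between detected modules whose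
source is injective (`FullyFaithfulInto.of_exact`). Since P is projective, F is exact, so F commutes
with cosyzygies of every summand of a module with a coresolution in add I; such summands are closed
under cosyzygies, so this can be iterated.

It remains to express φ, ψ and injective divisions by data that F preserves and reflects. All of
them reduce to isomorphism modulo maps through injectives (`StIso`), together with ordinary
isomorphism, direct summands and injectivity. By Krull-Schmidt cancellation, two classes in K₀ agree
exactly when the modules are stably isomorphic (`K0.mk_eq_mk_iff`), so φ only asks from which step
on the cosyzygy reflects stable isomorphism. By dimension shift, Ext^{d+1}(-, X) determines, and is
determined by, the stable class of Ω^{-d}(X) (`nonempty_extInto_succ_iso_iff`), while Ext^0 is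
handled by Yoneda. Injective dimension is read off from which cosyzygies are injective. Finally F
reflects stable isomorphism (`stIso_homP_iff`), and every summand of F Y is F of a summand of Y,
because idempotents lift (`exists_isSummand_homP_equiv`). -/

namespace IgusaTodorov

/-! ### Summands, injective envelopes and cosyzygies over an arbitrary ring. -/

section AnyRing

variable {A : Type u} [Ring A]

/-! ### Direct summands -/

theorem isSummand_iff {X M : ModuleCat.{u} A} :
    IsSummand X M ↔ ∃ (i : X →ₗ[A] M) (r : M →ₗ[A] X), r ∘ₗ i = LinearMap.id := by
  constructor
  · rintro ⟨h⟩
    exact ⟨h.i.hom, h.r.hom, by rw [← ModuleCat.hom_comp, h.retract]; rfl⟩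
  · rintro ⟨i, r, h⟩
    exact ⟨⟨ModuleCat.ofHom i, ModuleCat.ofHom r, by
      rw [← ModuleCat.ofHom_comp, h]; rfl⟩⟩

theorem IsSummand.refl (M : ModuleCat.{u} A) : IsSummand M M := ⟨Retract.refl M⟩

theorem IsSummand.trans {X M N : ModuleCat.{u} A} (h : IsSummand X M) (h' : IsSummand M N) :
    IsSummand X N := by
  obtain ⟨h⟩ := h
  obtain ⟨h'⟩ := h'
  exact ⟨h.trans h'⟩

theorem isSummand_of_equiv {M N : ModuleCat.{u} A} (e : M ≃ₗ[A] N) : IsSummand M N :=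
  isSummand_iff.2 ⟨e, e.symm, by ext; simp⟩

theorem isSummand_prod_left (M N : ModuleCat.{u} A) :
    IsSummand M (ModuleCat.of A (M × N)) :=
  isSummand_iff.2 ⟨LinearMap.inl A M N, LinearMap.fst A M N, LinearMap.fst_comp_inl A M N⟩

theorem isSummand_prod_right (M N : ModuleCat.{u} A) :
    IsSummand N (ModuleCat.of A (M × N)) :=
  isSummand_iff.2 ⟨LinearMap.inr A M N, LinearMap.snd A M N, LinearMap.snd_comp_inr A M N⟩

/-- A split monomorphism has a complement. -/
theorem exists_compl_of_comp_eq_id {X M : ModuleCat.{u} A} {i : X →ₗ[A] M} {r : M →ₗ[A] X}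
    (h : r ∘ₗ i = LinearMap.id) :
    ∃ (K : ModuleCat.{u} A) (s : K →ₗ[A] M) (t : M →ₗ[A] K), t ∘ₗ s = LinearMap.id ∧
      t ∘ₗ i = 0 ∧ Nonempty (M ≃ₗ[A] (X × K)) := by
  have hi : ∀ x, r (i x) = x := fun x => LinearMap.congr_fun h x
  let t : M →ₗ[A] LinearMap.ker r :=
    (LinearMap.id - i ∘ₗ r).codRestrict (LinearMap.ker r) fun x => by simp [hi]
  have ht : ∀ x, (t x : M) = x - i (r x) := fun _ => rfl
  refine ⟨ModuleCat.of A (LinearMap.ker r), (LinearMap.ker r).subtype, t, ?_, ?_,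
    ⟨LinearEquiv.ofLinearMap (r.prod t) (i.coprod (LinearMap.ker r).subtype) ?_ ?_⟩⟩
  · apply LinearMap.ext
    rintro ⟨k, hk⟩
    have hk' : r k = 0 := hk
    exact Subtype.ext (by simp [ht, hk'])
  · ext x
    simp [ht, hi]
  · apply LinearMap.ext
    rintro ⟨x, k, hk⟩
    have hk' : r k = 0 := hk
    refine Prod.ext (by simp [hi, hk']) (Subtype.ext ?_)
    simp [ht, hi, hk']
  · ext x
    simp [ht]

theorem IsSummand.finite {X M : ModuleCat.{u} A} (h : IsSummand X M) [Module.Finite A M] :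
    Module.Finite A X := by
  obtain ⟨i, r, h⟩ := isSummand_iff.1 h
  exact Module.Finite.of_surjective r fun x => ⟨i x, LinearMap.congr_fun h x⟩

theorem IsSummand.injective {X M : ModuleCat.{u} A} (h : IsSummand X M)
    (hM : Module.Injective A M) : Module.Injective A X := by
  obtain ⟨i, r, h⟩ := isSummand_iff.1 h
  refine ⟨fun P Q _ _ _ _ f hf g => ?_⟩
  obtain ⟨k, hk⟩ := hM.out f hf (i ∘ₗ g)
  exact ⟨r ∘ₗ k, fun x => by
    rw [LinearMap.comp_apply, hk]; exact LinearMap.congr_fun h (g x)⟩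

theorem IsSummand.prod {X M X' M' : ModuleCat.{u} A} (h : IsSummand X M) (h' : IsSummand X' M') :
    IsSummand (ModuleCat.of A (X × X')) (ModuleCat.of A (M × M')) := by
  obtain ⟨i, r, h⟩ := isSummand_iff.1 h
  obtain ⟨i', r', h'⟩ := isSummand_iff.1 h'
  exact isSummand_iff.2 ⟨i.prodMap i', r.prodMap r', by
    rw [LinearMap.prodMap_comp, h, h', LinearMap.prodMap_id]⟩

theorem IsSummand.pi {ι : Type} {X M : ModuleCat.{u} A} (h : IsSummand X M) :
    IsSummand (ModuleCat.of A (ι → X)) (ModuleCat.of A (ι → M)) := by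
  obtain ⟨i, r, h⟩ := isSummand_iff.1 h
  refine isSummand_iff.2 ⟨i.compLeft ι, r.compLeft ι, ?_⟩
  ext x j
  exact LinearMap.congr_fun h (x j)

theorem injective_prod {M N : ModuleCat.{u} A} (hM : Module.Injective A M)
    (hN : Module.Injective A N) : Module.Injective A (M × N) := by
  refine ⟨fun P Q _ _ _ _ f hf g => ?_⟩
  obtain ⟨k, hk⟩ := hM.out f hf (LinearMap.fst A M N ∘ₗ g)
  obtain ⟨l, hl⟩ := hN.out f hf (LinearMap.snd A M N ∘ₗ g)
  exact ⟨k.prod l, fun x => Prod.ext (hk x) (hl x)⟩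

theorem injective_of_equiv {M N : ModuleCat.{u} A} (e : M ≃ₗ[A] N)
    (hN : Module.Injective A N) : Module.Injective A M :=
  (isSummand_of_equiv e).injective hN

theorem injective_of_subsingleton (M : ModuleCat.{u} A) [Subsingleton M] : Module.Injective A M :=
  ⟨fun _ _ _ _ _ _ _ _ _ => ⟨0, fun _ => Subsingleton.elim _ _⟩⟩

theorem exists_extend {M N J : Type u} [AddCommGroup M] [Module A M] [AddCommGroup N] [Module A N]
    [AddCommGroup J] [Module A J] (hJ : Module.Injective A J) (f : M →ₗ[A] N)
    (hf : Function.Injective f) (g : M →ₗ[A] J) : ∃ h : N →ₗ[A] J, h ∘ₗ f = g := by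
  obtain ⟨h, hh⟩ := hJ.out f hf g
  exact ⟨h, LinearMap.ext hh⟩

theorem exists_desc {M E N K : Type u} [AddCommGroup M] [Module A M] [AddCommGroup E] [Module A E]
    [AddCommGroup N] [Module A N] [AddCommGroup K] [Module A K] {f : M →ₗ[A] E} {g : E →ₗ[A] N}
    (hfg : Function.Exact f g) (hg : Function.Surjective g) (h : E →ₗ[A] K) (hh : h ∘ₗ f = 0) :
    ∃ k : N →ₗ[A] K, k ∘ₗ g = h := by
  have hk : LinearMap.ker g ≤ LinearMap.ker h := by
    rw [hfg.linearMap_ker_eq]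
    rintro _ ⟨x, rfl⟩
    exact LinearMap.congr_fun hh x
  refine ⟨(LinearMap.ker g).liftQ h hk ∘ₗ (g.quotKerEquivOfSurjective hg).symm, ?_⟩
  ext x
  have : (g.quotKerEquivOfSurjective hg).symm (g x) = Submodule.Quotient.mk x := by
    rw [LinearEquiv.symm_apply_eq]; rfl
  simp only [LinearMap.comp_apply, LinearEquiv.coe_coe, this]
  rfl

theorem exists_lift_ker {X M E N : Type u} [AddCommGroup M] [Module A M] [AddCommGroup E]
    [Module A E] [AddCommGroup N] [Module A N] [AddCommGroup X] [Module A X] {f : M →ₗ[A] E}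
    {g : E →ₗ[A] N} (hf : Function.Injective f) (hfg : Function.Exact f g) (h : X →ₗ[A] E)
    (hh : g ∘ₗ h = 0) : ∃ k : X →ₗ[A] M, f ∘ₗ k = h := by
  have hk : ∀ x, h x ∈ LinearMap.range f := fun x => (hfg (h x)).1 (LinearMap.congr_fun hh x)
  refine ⟨(LinearEquiv.ofInjective f hf).symm ∘ₗ h.codRestrict _ hk, ?_⟩
  ext x
  have := (LinearEquiv.ofInjective f hf).apply_symm_apply (h.codRestrict _ hk x)
  exact congrArg Subtype.val this

/-! ### Injective envelopes -/

/-- Essentiality tested on the cyclic submodule generated by `x`; this elementwise form is the one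
used throughout. -/
theorem IsInjectiveEnvelope.exists_smul {M E : ModuleCat.{u} A} {f : M →ₗ[A] E}
    (hf : IsInjectiveEnvelope f) {x : E} (hx : x ≠ 0) :
    ∃ (a : A) (m : M), a • x = f m ∧ f m ≠ 0 := by
  by_contra! h
  have : Submodule.span A {x} ⊓ LinearMap.range f = ⊥ := by
    rw [eq_bot_iff]
    rintro y ⟨hy, m, rfl⟩
    obtain ⟨a, ha⟩ := Submodule.mem_span_singleton.1 hy
    exact h a m ha
  exact hx (Submodule.span_singleton_eq_bot.1 (hf.essential _ this))

theorem IsInjectiveEnvelope.of_exists_smul {M E : ModuleCat.{u} A} {f : M →ₗ[A] E}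
    (hE : Module.Injective A E) (hf : Function.Injective f)
    (h : ∀ x : E, x ≠ 0 → ∃ (a : A) (m : M), a • x = f m ∧ f m ≠ 0) : IsInjectiveEnvelope f where
  injective_module := hE
  injective := hf
  essential S hS := by
    rw [eq_bot_iff]
    intro x hx
    by_contra hx0
    obtain ⟨a, m, h1, h2⟩ := h x hx0
    apply h2
    have : f m ∈ S ⊓ LinearMap.range f := ⟨h1 ▸ S.smul_mem a hx, m, rfl⟩
    rw [hS] at this
    exact this

theorem IsInjectiveEnvelope.injective_of_comp {M E : ModuleCat.{u} A} {f : M →ₗ[A] E}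
    (hf : IsInjectiveEnvelope f) {N : Type u} [AddCommGroup N] [Module A N] (g : E →ₗ[A] N)
    (hg : Function.Injective (g ∘ₗ f)) : Function.Injective g := by
  rw [← LinearMap.ker_eq_bot]
  apply hf.essential
  rw [eq_bot_iff]
  rintro _ ⟨hy, m, rfl⟩
  have : m = 0 := hg (by simpa using hy)
  simp [this]

/-- Essentiality makes `u` injective, so injectivity of `E` gives a left inverse `v`. It also fixes
`f`, hence is injective too, and an injective left inverse is two-sided. -/
theorem IsInjectiveEnvelope.bijective_of_comp_eq {M E : ModuleCat.{u} A} {f : M →ₗ[A] E}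
    (hf : IsInjectiveEnvelope f) (u : E →ₗ[A] E) (hu : u ∘ₗ f = f) : Function.Bijective u := by
  have hinj : Function.Injective u := hf.injective_of_comp u (by rw [hu]; exact hf.injective)
  refine ⟨hinj, ?_⟩
  obtain ⟨v, hv⟩ := exists_extend hf.injective_module u hinj LinearMap.id
  have hvf : v ∘ₗ f = f := by
    conv_lhs => rw [← hu]
    rw [← LinearMap.comp_assoc, hv, LinearMap.id_comp]
  have hvinj : Function.Injective v := hf.injective_of_comp v (by rw [hvf]; exact hf.injective)
  intro y
  exact ⟨v y, hvinj (LinearMap.congr_fun hv (v y))⟩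

theorem IsInjectiveEnvelope.prodMap {M E M' E' : ModuleCat.{u} A} {f : M →ₗ[A] E}
    {f' : M' →ₗ[A] E'} (hf : IsInjectiveEnvelope f) (hf' : IsInjectiveEnvelope f') :
    IsInjectiveEnvelope (M := ModuleCat.of A (M × M')) (E := ModuleCat.of A (E × E'))
      (f.prodMap f') := by
  refine .of_exists_smul (injective_prod hf.injective_module hf'.injective_module)
    (hf.injective.prodMap hf'.injective) ?_
  -- Once the first coordinate lies in the image of `f`, a further scalar brings the second into the
  -- image of `f'` without moving the first out.
  have key : ∀ (m : M) (y : E'), (f m, y) ≠ 0 →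
      ∃ (a : A) (p : M × M'), a • (f m, y) = f.prodMap f' p ∧ f.prodMap f' p ≠ 0 := by
    intro m y h
    by_cases hy : y = 0
    · refine ⟨1, (m, 0), by simp [hy], ?_⟩
      simpa [hy] using h
    · obtain ⟨a, n, h1, h2⟩ := hf'.exists_smul hy
      refine ⟨a, (a • m, n), by simp [h1], fun h0 => h2 (congrArg Prod.snd h0)⟩
  rintro ⟨x, y⟩ hxy
  by_cases hx : x = 0
  · obtain ⟨a, p, h⟩ := key 0 y (by simpa [hx] using hxy)
    exact ⟨a, p, by simpa [hx] using h⟩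
  · obtain ⟨a, m, h1, h2⟩ := hf.exists_smul hx
    obtain ⟨b, p, h3, h4⟩ := key m (a • y) (fun h0 => h2 (congrArg Prod.fst h0))
    refine ⟨b * a, p, ?_, h4⟩
    rw [mul_smul, ← h3, ← h1]
    rfl

/-- Every module has an injective envelope. -/
theorem exists_isInjectiveEnvelope (M : ModuleCat.{u} A) :
    ∃ (E : ModuleCat.{u} A) (f : M →ₗ[A] E), IsInjectiveEnvelope f := by
  obtain ⟨⟨J, hJ, ι, hι⟩⟩ := EnoughInjectives.presentation M
  have hJ' : Module.Injective A J := (Module.injective_iff_injective_object A J).2 hJ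
  have hι' : Function.Injective ι.hom := (ModuleCat.mono_iff_injective ι).1 hι
  set R := LinearMap.range ι.hom
  -- a maximal essential extension of `M` inside `J`
  let ess : Set (Submodule A J) := {S | R ≤ S ∧ ∀ T ≤ S, T ⊓ R = ⊥ → T = ⊥}
  obtain ⟨S, hRS, hS⟩ : ∃ S, R ≤ S ∧ Maximal (· ∈ ess) S := by
    refine zorn_le_nonempty₀ ess (fun c hc hchain y hy => ?_) R
      ⟨le_rfl, fun T hT h => by rwa [inf_eq_left.2 hT] at h⟩
    refine ⟨sSup c, ⟨(hc hy).1.trans (le_sSup hy), fun T hT h => ?_⟩, fun z hz => le_sSup hz⟩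
    rw [eq_bot_iff]
    intro x hx
    obtain ⟨z, hz, hxz⟩ := (Submodule.mem_sSup_of_directed ⟨y, hy⟩ hchain.directedOn).1 (hT hx)
    have := (hc hz).2 (Submodule.span A {x}) (by simpa using hxz) (by
      rw [eq_bot_iff, ← h]
      exact inf_le_inf_right _ (by simpa using hx))
    simpa using this
  -- a maximal submodule intersecting `S` trivially
  obtain ⟨C, -, hC⟩ : ∃ C, ⊥ ≤ C ∧ Maximal (· ∈ {C : Submodule A J | S ⊓ C = ⊥}) C := by
    refine zorn_le_nonempty₀ _ (fun c hc hchain y hy => ?_) ⊥ (by simp)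
    refine ⟨sSup c, ?_, fun z hz => le_sSup hz⟩
    simp only [Set.mem_ofPred_eq, eq_bot_iff]
    rintro x ⟨hxS, hx⟩
    obtain ⟨z, hz, hxz⟩ := (Submodule.mem_sSup_of_directed ⟨y, hy⟩ hchain.directedOn).1 hx
    rw [← show S ⊓ z = ⊥ from hc hz]
    exact ⟨hxS, hxz⟩
  have hSC : S ⊓ C = ⊥ := hC.prop
  let q : S →ₗ[A] J ⧸ C := C.mkQ ∘ₗ S.subtype
  have hq : Function.Injective q := by
    rw [injective_iff_map_eq_zero]
    rintro ⟨x, hx⟩ h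
    have hxC : x ∈ C := by simpa [q] using h
    have : x ∈ S ⊓ C := ⟨hx, hxC⟩
    rw [hSC] at this
    exact Subtype.ext this
  obtain ⟨u, hu⟩ := exists_extend hJ' q hq S.subtype
  have huS : ∀ x ∈ S, u (Submodule.Quotient.mk x) = x := fun x hx =>
    LinearMap.congr_fun hu ⟨x, hx⟩
  -- the image of `q` is essential in `J / C`
  have hess : ∀ T : Submodule A (J ⧸ C), T ⊓ LinearMap.range q = ⊥ → T = ⊥ := by
    intro T hT
    have h1 : S ⊓ T.comap C.mkQ = ⊥ := by
      rw [eq_bot_iff]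
      rintro x ⟨hxS, hxT⟩
      have : q ⟨x, hxS⟩ ∈ T ⊓ LinearMap.range q := ⟨hxT, _, rfl⟩
      rw [hT] at this
      have := hq (this.trans (map_zero q).symm)
      simpa using this
    have h2 : T.comap C.mkQ ≤ C := hC.le_of_ge h1 (fun x hx => by
      have : C.mkQ x = 0 := by simpa using hx
      simp [this])
    rw [eq_bot_iff]
    intro y hy
    obtain ⟨x, rfl⟩ := C.mkQ_surjective y
    simpa using h2 hy
  have hess' : ∀ y : J ⧸ C, y ≠ 0 → ∃ (a : A) (s : S), a • y = q s ∧ s ≠ 0 := by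
    intro y hy
    by_contra! h
    apply hy
    have := hess (Submodule.span A {y}) (by
      rw [eq_bot_iff]
      rintro z ⟨hz, s, rfl⟩
      obtain ⟨a, ha⟩ := Submodule.mem_span_singleton.1 hz
      simp [h a s ha])
    exact Submodule.span_singleton_eq_bot.1 this
  have hrange : LinearMap.range u ≤ S := by
    refine hS.le_of_ge ⟨?_, ?_⟩ (fun x hx => ⟨_, huS x hx⟩)
    · intro x hx
      exact ⟨_, huS x (hRS hx)⟩
    · intro T hT h
      have hTS : T ⊓ S = ⊥ := hS.prop.2 _ inf_le_right (by
        rw [eq_bot_iff, ← h]; exact inf_le_inf_right _ inf_le_left)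
      rw [eq_bot_iff]
      intro t ht
      obtain ⟨y, rfl⟩ := hT ht
      by_contra hne
      obtain ⟨a, s, h1, h2⟩ := hess' y (by rintro rfl; simp at hne)
      have h3 : a • u y = s := by rw [← map_smul, h1]; exact huS s s.2
      have : (s : J) ∈ T ⊓ S := ⟨h3 ▸ T.smul_mem a ht, s.2⟩
      rw [hTS] at this
      exact h2 (Subtype.ext this)
  have hsum : IsSummand (ModuleCat.of A S) J := isSummand_iff.2
    ⟨S.subtype, (u ∘ₗ C.mkQ).codRestrict S (fun x => hrange ⟨_, rfl⟩), by
      ext x; exact huS x x.2⟩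
  refine ⟨ModuleCat.of A S, ι.hom.codRestrict S fun x => hRS ⟨x, rfl⟩,
    hsum.injective hJ', fun x y h => hι' (congrArg Subtype.val h), fun T hT => ?_⟩
  have := hS.prop.2 (T.map S.subtype) (Submodule.map_subtype_le S T) (by
    rw [eq_bot_iff]
    rintro _ ⟨⟨t, ht, rfl⟩, m, hm⟩
    have : t ∈ T ⊓ LinearMap.range (ι.hom.codRestrict S fun x => hRS ⟨x, rfl⟩) :=
      ⟨ht, m, Subtype.ext hm⟩
    rw [hT] at this
    have h0 : t = 0 := this
    simp [h0])
  exact Submodule.map_injective_of_injective S.injective_subtype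
    (this.trans (Submodule.map_bot _).symm)

/-! ### Cosyzygies -/

theorem exists_isCosyzygy (M : ModuleCat.{u} A) : ∃ N, IsCosyzygy M N := by
  obtain ⟨E, f, hf⟩ := exists_isInjectiveEnvelope M
  exact ⟨ModuleCat.of A (E ⧸ LinearMap.range f), E, f, (LinearMap.range f).mkQ, hf,
    LinearMap.exact_map_mkQ_range f, Submodule.mkQ_surjective _⟩

theorem exists_coker_map {M E N M' E' N' : Type u} [AddCommGroup M] [Module A M] [AddCommGroup E]
    [Module A E] [AddCommGroup N] [Module A N] [AddCommGroup M'] [Module A M'] [AddCommGroup E']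
    [Module A E'] [AddCommGroup N'] [Module A N'] {f : M →ₗ[A] E} {g : E →ₗ[A] N}
    (hfg : Function.Exact f g) (hg : Function.Surjective g) {f' : M' →ₗ[A] E'} {g' : E' →ₗ[A] N'}
    (hfg' : Function.Exact f' g') (i : M →ₗ[A] M') (a : E →ₗ[A] E') (h : a ∘ₗ f = f' ∘ₗ i) :
    ∃ k : N →ₗ[A] N', k ∘ₗ g = g' ∘ₗ a :=
  exists_desc hfg hg (g' ∘ₗ a) (by
    rw [LinearMap.comp_assoc, h, ← LinearMap.comp_assoc, hfg'.linearMap_comp_eq_zero,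
      LinearMap.zero_comp])

theorem bijective_coker_map {M E N : Type u} [AddCommGroup M] [Module A M] [AddCommGroup E]
    [Module A E] [AddCommGroup N] [Module A N] {f : M →ₗ[A] E} {g : E →ₗ[A] N}
    (hfg : Function.Exact f g) (hg : Function.Surjective g) {u : E →ₗ[A] E} (hu : u ∘ₗ f = f)
    (hbij : Function.Bijective u) {k : N →ₗ[A] N} (hk : k ∘ₗ g = g ∘ₗ u) :
    Function.Bijective k := by
  constructor
  · rw [injective_iff_map_eq_zero]
    intro n hn
    obtain ⟨e, rfl⟩ := hg n
    have h1 : g (u e) = 0 := (LinearMap.congr_fun hk e).symm.trans hn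
    obtain ⟨m, hm⟩ := (hfg _).1 h1
    have h2 : e = f m := hbij.1 (hm.symm.trans (LinearMap.congr_fun hu m).symm)
    rw [h2]
    exact hfg.apply_apply_eq_zero m
  · intro n
    obtain ⟨e, rfl⟩ := hg n
    obtain ⟨e', rfl⟩ := hbij.2 e
    exact ⟨g e', LinearMap.congr_fun hk e'⟩

/-- The cosyzygy of a direct summand of `M'` is a direct summand of the cokernel of any embedding of
`M'` into an injective module. -/
theorem IsCosyzygy.isSummand_coker {M N M' J K : ModuleCat.{u} A} (h : IsSummand M M')
    (hN : IsCosyzygy M N) (hJ : Module.Injective A J) {f' : M' →ₗ[A] J} {g' : J →ₗ[A] K}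
    (hf' : Function.Injective f') (hfg' : Function.Exact f' g') (hg' : Function.Surjective g') :
    IsSummand N K := by
  obtain ⟨i, r, hir⟩ := isSummand_iff.1 h
  obtain ⟨E, f, g, hf, hfg, hg⟩ := hN
  obtain ⟨a, ha⟩ := exists_extend hJ f hf.injective (f' ∘ₗ i)
  obtain ⟨b, hb⟩ := exists_extend hf.injective_module f' hf' (f ∘ₗ r)
  have hba : (b ∘ₗ a) ∘ₗ f = f := by
    rw [LinearMap.comp_assoc, ha, ← LinearMap.comp_assoc, hb, LinearMap.comp_assoc, hir,
      LinearMap.comp_id]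
  obtain ⟨a', ha'⟩ := exists_coker_map hfg hg hfg' i a ha
  obtain ⟨b', hb'⟩ := exists_coker_map hfg' hg' hfg r b hb
  -- The composite `b ∘ a` fixes the envelope `f`, so it is an automorphism of `E` and induces one
  -- on the cokernel; correcting `b'` by its inverse splits `a'`.
  have hbij : Function.Bijective (b' ∘ₗ a') :=
    bijective_coker_map hfg hg hba (hf.bijective_of_comp_eq _ hba) (by
      rw [LinearMap.comp_assoc, ha', ← LinearMap.comp_assoc, hb', LinearMap.comp_assoc])
  refine isSummand_iff.2 ⟨a', (LinearEquiv.ofBijective _ hbij).symm ∘ₗ b', ?_⟩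
  ext x
  exact (LinearEquiv.ofBijective _ hbij).symm_apply_apply x

theorem IsCosyzygy.unique {M N M' N' : ModuleCat.{u} A} (e : M ≃ₗ[A] M')
    (hN : IsCosyzygy M N) (hN' : IsCosyzygy M' N') : Nonempty (N ≃ₗ[A] N') := by
  obtain ⟨E, f, g, hf, hfg, hg⟩ := hN
  obtain ⟨E', f', g', hf', hfg', hg'⟩ := hN'
  obtain ⟨a, ha⟩ := exists_extend hf'.injective_module f hf.injective (f' ∘ₗ e)
  obtain ⟨b, hb⟩ := exists_extend hf.injective_module f' hf'.injective (f ∘ₗ e.symm)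
  have hba : (b ∘ₗ a) ∘ₗ f = f := by
    rw [LinearMap.comp_assoc, ha, ← LinearMap.comp_assoc, hb]; ext; simp
  have hab : (a ∘ₗ b) ∘ₗ f' = f' := by
    rw [LinearMap.comp_assoc, hb, ← LinearMap.comp_assoc, ha]; ext; simp
  obtain ⟨a', ha'⟩ := exists_coker_map hfg hg hfg' e a ha
  obtain ⟨b', hb'⟩ := exists_coker_map hfg' hg' hfg e.symm b hb
  have h1 : Function.Bijective (b' ∘ₗ a') :=
    bijective_coker_map hfg hg hba (hf.bijective_of_comp_eq _ hba) (by
      rw [LinearMap.comp_assoc, ha', ← LinearMap.comp_assoc, hb', LinearMap.comp_assoc])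
  have h2 : Function.Bijective (a' ∘ₗ b') :=
    bijective_coker_map hfg' hg' hab (hf'.bijective_of_comp_eq _ hab) (by
      rw [LinearMap.comp_assoc, hb', ← LinearMap.comp_assoc, ha', LinearMap.comp_assoc])
  rw [LinearMap.coe_comp] at h1 h2
  exact ⟨LinearEquiv.ofBijective a' ⟨h1.1.of_comp, h2.2.of_comp⟩⟩

theorem IsCosyzygy.congr {M N M' N' : ModuleCat.{u} A} (e : M ≃ₗ[A] M') (e' : N ≃ₗ[A] N')
    (h : IsCosyzygy M N) : IsCosyzygy M' N' := by
  obtain ⟨E, f, g, hf, hfg, hg⟩ := h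
  have hr : LinearMap.range (f ∘ₗ e.symm.toLinearMap) = LinearMap.range f :=
    LinearMap.range_comp_of_range_eq_top _ (LinearEquiv.range e.symm)
  refine ⟨E, f ∘ₗ e.symm, e' ∘ₗ g, ⟨hf.injective_module, hf.injective.comp e.symm.injective,
    fun S hS => hf.essential S (by rwa [hr] at hS)⟩, ?_, e'.surjective.comp hg⟩
  rw [LinearMap.exact_iff, hr, ← hfg.linearMap_ker_eq]
  ext x
  simp

theorem IsCosyzygy.prod {M N M' N' : ModuleCat.{u} A} (h : IsCosyzygy M N)
    (h' : IsCosyzygy M' N') :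
    IsCosyzygy (ModuleCat.of A (M × M')) (ModuleCat.of A (N × N')) := by
  obtain ⟨E, f, g, hf, hfg, hg⟩ := h
  obtain ⟨E', f', g', hf', hfg', hg'⟩ := h'
  refine ⟨ModuleCat.of A (E × E'), f.prodMap f', g.prodMap g', hf.prodMap hf', ?_,
    hg.prodMap hg'⟩
  rintro ⟨x, y⟩
  constructor
  · intro h
    obtain ⟨m, hm⟩ := (hfg x).1 (congrArg Prod.fst h)
    obtain ⟨n, hn⟩ := (hfg' y).1 (congrArg Prod.snd h)
    exact ⟨(m, n), Prod.ext hm hn⟩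
  · rintro ⟨⟨m, n⟩, h⟩
    rw [← h]
    exact Prod.ext (hfg.apply_apply_eq_zero m) (hfg'.apply_apply_eq_zero n)

theorem IsCosyzygy.subsingleton {M N : ModuleCat.{u} A} (h : IsCosyzygy M N)
    (hM : Module.Injective A M) : Subsingleton N := by
  have h' : IsCosyzygy M (ModuleCat.of A PUnit.{u + 1}) := by
    refine ⟨M, LinearMap.id, 0, ⟨hM, Function.injective_id, fun S hS => by simpa using hS⟩,
      fun x => ?_, fun x => ⟨0, rfl⟩⟩
    simp
  obtain ⟨e⟩ := h.unique (LinearEquiv.refl A M) h'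
  exact e.toEquiv.subsingleton

theorem IsCosyzygy.injective_of_subsingleton {M N : ModuleCat.{u} A} (h : IsCosyzygy M N)
    [Subsingleton N] : Module.Injective A M := by
  obtain ⟨E, f, g, hf, hfg, hg⟩ := h
  have hs : Function.Surjective f := fun x => (hfg x).1 (Subsingleton.elim _ _)
  exact injective_of_equiv (LinearEquiv.ofBijective f ⟨hf.injective, hs⟩) hf.injective_module

theorem isNthCosyzygy_zero_iff {M N : ModuleCat.{u} A} :
    IsNthCosyzygy 0 M N ↔ Nonempty (M ≃ₗ[A] N) :=
  ⟨fun ⟨e⟩ => ⟨e.toLinearEquiv⟩, fun ⟨e⟩ => ⟨e.toModuleIso⟩⟩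

theorem IsNthCosyzygy.refl (M : ModuleCat.{u} A) : IsNthCosyzygy 0 M M :=
  isNthCosyzygy_zero_iff.2 ⟨LinearEquiv.refl A M⟩

theorem IsNthCosyzygy.succ {n : ℕ} {M K N : ModuleCat.{u} A} (h : IsNthCosyzygy n M K)
    (h' : IsCosyzygy K N) : IsNthCosyzygy (n + 1) M N := ⟨K, h, h'⟩

theorem exists_isNthCosyzygy (n : ℕ) (M : ModuleCat.{u} A) : ∃ N, IsNthCosyzygy n M N := by
  induction n with
  | zero => exact ⟨M, .refl M⟩
  | succ n ih =>
    obtain ⟨K, hK⟩ := ih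
    obtain ⟨N, hN⟩ := exists_isCosyzygy K
    exact ⟨N, hK.succ hN⟩

theorem IsNthCosyzygy.unique {n : ℕ} {M N M' N' : ModuleCat.{u} A} (e : M ≃ₗ[A] M')
    (h : IsNthCosyzygy n M N) (h' : IsNthCosyzygy n M' N') : Nonempty (N ≃ₗ[A] N') := by
  induction n generalizing N N' with
  | zero =>
    obtain ⟨a⟩ := isNthCosyzygy_zero_iff.1 h
    obtain ⟨b⟩ := isNthCosyzygy_zero_iff.1 h'
    exact ⟨a.symm ≪≫ₗ e ≪≫ₗ b⟩
  | succ n ih =>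
    obtain ⟨K, hK, hN⟩ := h
    obtain ⟨K', hK', hN'⟩ := h'
    obtain ⟨e'⟩ := ih hK hK'
    exact hN.unique e' hN'

theorem IsNthCosyzygy.congr {n : ℕ} {M N M' N' : ModuleCat.{u} A} (e : M ≃ₗ[A] M')
    (e' : N ≃ₗ[A] N') (h : IsNthCosyzygy n M N) : IsNthCosyzygy n M' N' := by
  induction n generalizing N N' with
  | zero =>
    obtain ⟨a⟩ := isNthCosyzygy_zero_iff.1 h
    exact isNthCosyzygy_zero_iff.2 ⟨e.symm ≪≫ₗ a ≪≫ₗ e'⟩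
  | succ n ih =>
    obtain ⟨K, hK, hN⟩ := h
    exact ⟨K, ih (LinearEquiv.refl A K) hK, hN.congr (LinearEquiv.refl A K) e'⟩

/-- The definition peels off the last cosyzygy; this and its converse `unshift` peel off the first,
as inductions on `M` require. -/
theorem IsNthCosyzygy.shift {n : ℕ} {M K N : ModuleCat.{u} A} (h : IsCosyzygy M K)
    (h' : IsNthCosyzygy n K N) : IsNthCosyzygy (n + 1) M N := by
  induction n generalizing N with
  | zero =>
    obtain ⟨a⟩ := isNthCosyzygy_zero_iff.1 h'
    exact (IsNthCosyzygy.refl M).succ (h.congr (LinearEquiv.refl A M) a)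
  | succ n ih =>
    obtain ⟨L, hL, hN⟩ := h'
    exact ⟨L, ih hL, hN⟩

theorem IsNthCosyzygy.unshift {n : ℕ} {M K N : ModuleCat.{u} A} (h : IsCosyzygy M K)
    (h' : IsNthCosyzygy (n + 1) M N) : IsNthCosyzygy n K N := by
  obtain ⟨N', hN'⟩ := exists_isNthCosyzygy n K
  obtain ⟨e⟩ := (hN'.shift h).unique (LinearEquiv.refl A M) h'
  exact hN'.congr (LinearEquiv.refl A K) e

end AnyRing

end IgusaTodorov

namespace IgusaTodorov

/-! ### Finiteness of injective envelopes over artin algebras. -/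

section ArtinAlgebra

/-- Over an artin algebra, the injective envelope of a finitely generated module is finitely
generated. -/
theorem IsInjectiveEnvelope.finite_of_artinAlgebra (R : Type*) [CommRing R] [IsArtinianRing R]
    {A : Type u} [Ring A] [Algebra R A] [Module.Finite R A] {M E : ModuleCat.{u} A}
    [Module.Finite A M] {f : M →ₗ[A] E} (hf : IsInjectiveEnvelope f) : Module.Finite A E := by
  let : Module R M := Module.compHom M (algebraMap R A)
  let : Module R E := Module.compHom E (algebraMap R A)
  have : IsScalarTower R A M := ⟨fun r a x => by
    rw [Algebra.smul_def, mul_smul]; rfl⟩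
  have : IsScalarTower R A E := ⟨fun r a x => by
    rw [Algebra.smul_def, mul_smul]; rfl⟩
  have : SMulCommClass A R E := ⟨fun a r x => by
    change a • (algebraMap R A r • x) = algebraMap R A r • (a • x)
    rw [smul_smul, smul_smul, Algebra.commutes]⟩
  have : Module.Finite R M := Module.Finite.trans A M
  have : IsArtinianRing A := IsArtinianRing.of_finite R A
  -- By essentiality the image of a simple module in `E` lies in the image of `f`, so evaluation at
  -- a generator embeds `Hom(S, E)` into a noetherian `R`-module.
  have hsimple : ∀ (S : Type u) [AddCommGroup S] [Module A S] [IsSimpleModule A S],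
      IsNoetherian R (S →ₗ[A] E) := by
    intro S _ _ _
    have := IsSimpleModule.nontrivial A S
    obtain ⟨x, hx⟩ := exists_ne (0 : S)
    have hspan : ∀ y : S, ∃ a : A, a • x = y := fun y => by
      have := IsSimpleModule.span_singleton_eq_top A hx
      exact Submodule.mem_span_singleton.1 (this ▸ Submodule.mem_top)
    have hmem : ∀ φ : S →ₗ[A] E, φ x ∈ LinearMap.range (f.restrictScalars R) := by
      intro φ
      by_cases h0 : φ x = 0
      · rw [h0]; exact zero_mem _
      · obtain ⟨a, m, h1, h2⟩ := hf.exists_smul h0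
        rw [← map_smul] at h1
        have hax : a • x ≠ 0 := fun h => h2 (by rw [← h1, h, map_zero])
        have := IsSimpleModule.span_singleton_eq_top A hax
        obtain ⟨b, hb⟩ := Submodule.mem_span_singleton.1
          (this ▸ Submodule.mem_top : x ∈ Submodule.span A {a • x})
        exact ⟨b • m, by
          change f (b • m) = φ x
          rw [map_smul, ← h1, ← map_smul, hb]⟩
    let ev : (S →ₗ[A] E) →ₗ[R] LinearMap.range (f.restrictScalars R) :=
      { toFun := fun φ => ⟨φ x, hmem φ⟩
        map_add' := fun _ _ => rfl
        map_smul' := fun _ _ => rfl }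
    refine isNoetherian_of_injective ev fun φ ψ h => ?_
    ext y
    obtain ⟨a, rfl⟩ := hspan y
    rw [map_smul, map_smul]
    exact congrArg (a • ·) (congrArg Subtype.val h)
  -- Induction along a composition series by left exactness of `Hom(-, E)`. The case `N = A` then
  -- gives `E` itself, as `Hom(A, E) ≃ E`.
  have hlength : ∀ (N : Type u) [AddCommGroup N] [Module A N], IsFiniteLength A N →
      IsNoetherian R (N →ₗ[A] E) := by
    intro N _ _ hN
    induction hN with
    | of_subsingleton => infer_instance
    | @of_simple_quotient M _ _ N _ _ ih =>
      have := hsimple (M ⧸ N)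
      refine isNoetherian_of_range_eq_ker (M := (M ⧸ N) →ₗ[A] E) (P := N →ₗ[A] E)
        { toFun := fun φ => φ ∘ₗ N.mkQ
          map_add' := fun _ _ => rfl
          map_smul' := fun _ _ => rfl }
        { toFun := fun φ => φ ∘ₗ N.subtype
          map_add' := fun _ _ => rfl
          map_smul' := fun _ _ => rfl } ?_
      ext φ
      constructor
      · rintro ⟨ψ, rfl⟩
        ext x
        have : N.mkQ (x : M) = 0 := by simp
        change ψ (N.mkQ x) = 0
        rw [this, map_zero]
      · intro h
        exact ⟨N.liftQ φ fun x hx => LinearMap.congr_fun h ⟨x, hx⟩, by ext; rfl⟩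
  have := hlength A (isFiniteLength_iff_isNoetherian_isArtinian.2 ⟨inferInstance, inferInstance⟩)
  have : Module.Finite R E := Module.Finite.equiv (LinearMap.ringLmapEquivSelf A R E)
  exact Module.Finite.of_restrictScalars_finite R A E

/-- An artinian ring over which injective envelopes of finitely generated modules are finitely
generated, for instance an artin algebra. -/
class HasFiniteEnvelopes (A : Type u) [Ring A] : Prop where
  isArtinianRing : IsArtinianRing A
  finite {M E : ModuleCat.{u} A} [Module.Finite A M] {f : M →ₗ[A] E}
    (hf : IsInjectiveEnvelope f) : Module.Finite A E

instance (A : Type u) [Ring A] [h : HasFiniteEnvelopes A] : IsArtinianRing A := h.isArtinianRing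

theorem hasFiniteEnvelopes_of_artinAlgebra (R : Type*) [CommRing R] [IsArtinianRing R]
    (A : Type u) [Ring A] [Algebra R A] [Module.Finite R A] : HasFiniteEnvelopes A where
  isArtinianRing := IsArtinianRing.of_finite R A
  finite hf := hf.finite_of_artinAlgebra R

variable {A : Type u} [Ring A] [HasFiniteEnvelopes A]

theorem IsCosyzygy.finite {M N : ModuleCat.{u} A} [Module.Finite A M] (h : IsCosyzygy M N) :
    Module.Finite A N := by
  obtain ⟨E, f, g, hf, -, hg⟩ := h
  have := HasFiniteEnvelopes.finite hf
  exact Module.Finite.of_surjective g hg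

theorem IsNthCosyzygy.finite {n : ℕ} {M N : ModuleCat.{u} A} [Module.Finite A M]
    (h : IsNthCosyzygy n M N) : Module.Finite A N := by
  induction n generalizing N with
  | zero =>
    obtain ⟨e⟩ := isNthCosyzygy_zero_iff.1 h
    exact Module.Finite.equiv e
  | succ n ih =>
    obtain ⟨K, hK, hN⟩ := h
    have := ih hK
    exact hN.finite

end ArtinAlgebra

end IgusaTodorov

namespace IgusaTodorov

/-! ### Additive closures, local endomorphism rings and Krull-Schmidt cancellation. -/

section KrullSchmidt

variable {A : Type u} [Ring A]

/-! ### Closure properties of `add` -/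

theorem InAdd.of_isSummand {X M : ModuleCat.{u} A} (h : IsSummand X M) : InAdd X M :=
  ⟨1, h.trans (isSummand_of_equiv (N := ModuleCat.of A (Fin 1 → M))
    (LinearEquiv.funUnique (Fin 1) A M).symm)⟩

theorem InAdd.of_summand {X X' M : ModuleCat.{u} A} (h : IsSummand X X') (h' : InAdd X' M) :
    InAdd X M := by
  obtain ⟨n, hn⟩ := h'
  exact ⟨n, h.trans hn⟩

theorem InAdd.prod {X X' M : ModuleCat.{u} A} (h : InAdd X M) (h' : InAdd X' M) :
    InAdd (ModuleCat.of A (X × X')) M := by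
  obtain ⟨n, hn⟩ := h
  obtain ⟨m, hm⟩ := h'
  exact ⟨n + m, (hn.prod hm).trans (isSummand_of_equiv
    (M := ModuleCat.of A ((Fin n → M) × (Fin m → M))) (N := ModuleCat.of A (Fin (n + m) → M))
    ((LinearEquiv.sumArrowLequivProdArrow (Fin n) (Fin m) A M).symm ≪≫ₗ
      LinearEquiv.funCongrLeft A M finSumFinEquiv.symm))⟩

theorem InAdd.pi {X M : ModuleCat.{u} A} (h : InAdd X M) (k : ℕ) :
    InAdd (ModuleCat.of A (Fin k → X)) M := by
  obtain ⟨n, hn⟩ := h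
  exact ⟨k * n, hn.pi.trans (isSummand_of_equiv
    (M := ModuleCat.of A (Fin k → Fin n → M)) (N := ModuleCat.of A (Fin (k * n) → M))
    ((LinearEquiv.curry A M (Fin k) (Fin n)).symm ≪≫ₗ
      LinearEquiv.funCongrLeft A M finProdFinEquiv.symm))⟩

theorem InAdd.trans {X M N : ModuleCat.{u} A} (h : InAdd X M) (h' : InAdd M N) : InAdd X N := by
  obtain ⟨n, hn⟩ := h
  exact .of_summand hn (h'.pi n)

theorem InAdd.finite {X M : ModuleCat.{u} A} [Module.Finite A M] (h : InAdd X M) :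
    Module.Finite A X := by
  obtain ⟨n, hn⟩ := h
  have : Module.Finite A (ModuleCat.of A (Fin n → M)) :=
    inferInstanceAs (Module.Finite A (Fin n → M))
  exact hn.finite

/-! ### Indecomposable modules of finite length -/

/-- The endomorphism ring of an indecomposable module of finite length is local. -/
theorem IsIndecomposable.isUnit_or [IsArtinianRing A] {X : ModuleCat.{u} A} [Module.Finite A X]
    (h : IsIndecomposable X) (φ : Module.End A X) : IsUnit φ ∨ IsUnit (1 - φ) := by
  -- Fitting decomposition: one of the kernel and the image of `φ ^ n` vanishes, so `φ` is
  -- invertible or nilpotent. The bound `n ≥ 1` lets invertibility descend from `φ ^ n` to `φ`.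
  obtain ⟨n, hn, hn1⟩ :=
    (φ.eventually_isCompl_ker_pow_range_pow.and (Filter.eventually_ge_atTop 1)).exists
  obtain h1 | h1 := h.2 (ModuleCat.of A (LinearMap.ker (φ ^ n)))
    (ModuleCat.of A (LinearMap.range (φ ^ n))) ⟨(Submodule.prodEquivOfIsCompl _ _ hn).symm⟩
  · left
    have hk : LinearMap.ker (φ ^ n) = ⊥ := (Submodule.subsingleton_iff_eq_bot).1 h1
    have hr : LinearMap.range (φ ^ n) = ⊤ := by
      have := hn.sup_eq_top
      rwa [hk, bot_sup_eq] at this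
    have : IsUnit (φ ^ n) := (Module.End.isUnit_iff _).2
      ⟨LinearMap.ker_eq_bot.1 hk, LinearMap.range_eq_top.1 hr⟩
    exact (isUnit_pow_iff (by lia)).1 this
  · right
    have hr : LinearMap.range (φ ^ n) = ⊥ := (Submodule.subsingleton_iff_eq_bot).1 h1
    exact IsNilpotent.isUnit_one_sub ⟨n, LinearMap.range_eq_bot.1 hr⟩

theorem finite_prod_left {C C₁ C₂ : ModuleCat.{u} A} [Module.Finite A C]
    (e : C ≃ₗ[A] (C₁ × C₂)) : Module.Finite A C₁ :=
  ((isSummand_prod_left C₁ C₂).trans (isSummand_of_equiv e.symm)).finite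

theorem finite_prod_right {C C₁ C₂ : ModuleCat.{u} A} [Module.Finite A C]
    (e : C ≃ₗ[A] (C₁ × C₂)) : Module.Finite A C₂ :=
  ((isSummand_prod_right C₁ C₂).trans (isSummand_of_equiv e.symm)).finite

/-- Induction over decompositions into indecomposable modules. -/
theorem indecomposable_induction [IsArtinianRing A] {P : ModuleCat.{u} A → Prop}
    (zero : ∀ C : ModuleCat.{u} A, Subsingleton C → P C)
    (indecomposable : ∀ C : ModuleCat.{u} A, Module.Finite A C → IsIndecomposable C → P C)
    (prod : ∀ C C₁ C₂ : ModuleCat.{u} A, Module.Finite A C → (C ≃ₗ[A] (C₁ × C₂)) →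
      P C₁ → P C₂ → P C)
    (C : ModuleCat.{u} A) [hC : Module.Finite A C] : P C := by
  have hlen : ∀ (C : ModuleCat.{u} A) [Module.Finite A C],
      Module.length A C ≠ ⊤ := fun C _ => Module.length_ne_top
  generalize hn : (Module.length A C).toNat = n
  induction n using Nat.strong_induction_on generalizing C with
  | _ n ih =>
    obtain hs | hs := subsingleton_or_nontrivial C
    · exact zero C hs
    by_cases hind : IsIndecomposable C
    · exact indecomposable C hC hind
    have : ∃ C₁ C₂ : ModuleCat.{u} A, ∃ _ : C ≃ₗ[A] (C₁ × C₂),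
        Nontrivial C₁ ∧ Nontrivial C₂ := by
      by_contra! h
      refine hind ⟨hs, fun X Y ⟨e⟩ => ?_⟩
      by_contra! h'
      exact not_subsingleton_iff_nontrivial.2 h'.2
        (not_nontrivial_iff_subsingleton.1 (not_nontrivial_iff_subsingleton.2 (h X Y e h'.1)))
    obtain ⟨C₁, C₂, e, h₁, h₂⟩ := this
    have := finite_prod_left e
    have := finite_prod_right e
    have hl : (Module.length A C).toNat =
        (Module.length A C₁).toNat + (Module.length A C₂).toNat := by
      rw [e.length_eq, Module.length_prod, ENat.toNat_add (hlen C₁) (hlen C₂)]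
    have p₁ : 0 < (Module.length A C₁).toNat :=
      Nat.pos_of_ne_zero fun h => by
        rw [ENat.toNat_eq_zero] at h
        exact (Module.length_pos (R := A) (M := C₁)).ne' (h.resolve_right (hlen C₁))
    have p₂ : 0 < (Module.length A C₂).toNat :=
      Nat.pos_of_ne_zero fun h => by
        rw [ENat.toNat_eq_zero] at h
        exact (Module.length_pos (R := A) (M := C₂)).ne' (h.resolve_right (hlen C₂))
    exact prod C C₁ C₂ hC e (ih _ (by lia) C₁ rfl) (ih _ (by lia) C₂ rfl)

/-- In a local ring the nonunits are closed under addition. The second alternative covers the empty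
sum, where zero is a unit only for the zero module. -/
theorem exists_isUnit_of_sum {X : Type u} [AddCommGroup X] [Module A X]
    (hX : ∀ φ : Module.End A X, IsUnit φ ∨ IsUnit (1 - φ)) {ι : Type*} (s : Finset ι)
    (φ : ι → Module.End A X) (h : IsUnit (∑ j ∈ s, φ j)) :
    (∃ j ∈ s, IsUnit (φ j)) ∨ Subsingleton X := by
  classical
  induction s using Finset.induction_on with
  | empty =>
    right
    simp only [Finset.sum_empty, isUnit_zero_iff] at h
    refine ⟨fun x y => ?_⟩
    have hz : ∀ z : X, z = 0 := fun z => (LinearMap.congr_fun h z).symm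
    rw [hz x, hz y]
  | insert a s ha ih =>
    rw [Finset.sum_insert ha] at h
    obtain ⟨u, hu⟩ := h
    obtain h1 | h1 := hX (↑u⁻¹ * φ a)
    · exact .inl ⟨a, Finset.mem_insert_self a s, by simpa using h1⟩
    · have : 1 - ↑u⁻¹ * φ a = ↑u⁻¹ * ∑ j ∈ s, φ j := by
        rw [← Units.inv_mul u, hu, mul_add, add_sub_cancel_left]
      rw [this] at h1
      obtain ⟨j, hj, h2⟩ | h2 := ih (by simpa using h1)
      · exact .inl ⟨j, Finset.mem_insert_of_mem hj, h2⟩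
      · exact .inr h2

/-- An indecomposable module in `add M` is a direct summand of `M`. -/
theorem IsIndecomposable.isSummand [IsArtinianRing A] {X M : ModuleCat.{u} A} [Module.Finite A X]
    (h : IsIndecomposable X) (hXM : InAdd X M) : IsSummand X M := by
  obtain ⟨n, hn⟩ := hXM
  obtain ⟨i, r, hir⟩ := isSummand_iff.1 hn
  -- The identity of `X` is a sum of endomorphisms, each through one copy of `M`. One of them is a
  -- unit by locality, which splits `X` off that copy.
  have hsum : ∑ j : Fin n, (r ∘ₗ LinearMap.single A (fun _ => M) j) ∘ₗ (LinearMap.proj j ∘ₗ i) =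
      (1 : Module.End A X) := by
    ext x
    have : ∑ j, Pi.single (M := fun _ : Fin n => (M : Type u)) j ((i x : Fin n → M) j) = i x :=
      Finset.univ_sum_single _
    have h2 : r (∑ j, Pi.single (M := fun _ : Fin n => (M : Type u)) j ((i x : Fin n → M) j)) = x := by
      rw [this]; exact LinearMap.congr_fun hir x
    rw [map_sum] at h2
    simpa using h2
  obtain ⟨j, -, hj⟩ | hs := exists_isUnit_of_sum h.isUnit_or Finset.univ _ (hsum ▸ isUnit_one)
  · obtain ⟨u, hu⟩ := hj
    refine isSummand_iff.2 ⟨LinearMap.proj j ∘ₗ i,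
      (↑u⁻¹ : Module.End A X) ∘ₗ (r ∘ₗ LinearMap.single A (fun _ => M) j), ?_⟩
    rw [LinearMap.comp_assoc, ← hu]
    exact Units.inv_mul u
  · exact absurd hs (not_subsingleton_iff_nontrivial.2 h.1)

/-! ### Cancellation -/

/-- Gaussian elimination: since the `X`-corner of `φ` is invertible, each `b` has exactly one `t b`
for which `φ (t b, b)` has first coordinate zero. The second coordinate is then the required
isomorphism. -/
theorem cancel_of_bijective {X B B' : Type u} [AddCommGroup X] [Module A X] [AddCommGroup B]
    [Module A B] [AddCommGroup B'] [Module A B'] (φ : (X × B) ≃ₗ[A] (X × B'))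
    (h : Function.Bijective (LinearMap.fst A X B' ∘ₗ φ.toLinearMap ∘ₗ LinearMap.inl A X B)) :
    Nonempty (B ≃ₗ[A] B') := by
  let a := LinearEquiv.ofBijective _ h
  have ha : ∀ x, a x = (φ (x, 0)).1 := fun _ => rfl
  let t : B →ₗ[A] X := -(a.symm.toLinearMap ∘ₗ LinearMap.fst A X B' ∘ₗ φ.toLinearMap ∘ₗ
    LinearMap.inr A X B)
  have ht : ∀ b, (φ (t b, b)).1 = 0 := fun b => by
    have : ((t b, b) : X × B) = (t b, 0) + (0, b) := by simp
    rw [this, map_add, Prod.fst_add, ← ha]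
    simp [t]
  have ht' : ∀ x b, (φ (x, b)).1 = 0 → x = t b := fun x b hx => by
    apply a.injective
    rw [ha, ha]
    have h1 := hx.trans (ht b).symm
    have e1 : ∀ y : X, ((y, b) : X × B) = (y, 0) + (0, b) := by simp
    rw [e1, e1 (t b), map_add, map_add, Prod.fst_add, Prod.fst_add] at h1
    exact add_right_cancel h1
  let s : B →ₗ[A] B' := LinearMap.snd A X B' ∘ₗ φ.toLinearMap ∘ₗ t.prod LinearMap.id
  have hs : ∀ b, s b = (φ (t b, b)).2 := fun _ => rfl
  refine ⟨LinearEquiv.ofBijective s ⟨?_, fun b' => ?_⟩⟩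
  · rw [injective_iff_map_eq_zero]
    intro b hb
    have : φ (t b, b) = 0 := Prod.ext (ht b) ((hs b).symm.trans hb)
    exact congrArg Prod.snd (φ.map_eq_zero_iff.1 this)
  · have h1 : φ ((φ.symm (0, b')).1, (φ.symm (0, b')).2) = (0, b') := φ.apply_symm_apply _
    have h2 := ht' _ _ (congrArg Prod.fst h1)
    refine ⟨(φ.symm (0, b')).2, ?_⟩
    rw [hs, ← h2, h1]

/-- If the corner `a` of `φ` is not a unit, neither is `a' * a` by finite length. Locality and `a' a
+ b' c = 1` make `v = b' c` a unit, and then `a + v` as well, so a shear of the target makes the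
corner invertible. -/
theorem IsIndecomposable.cancel [IsArtinianRing A] {X : ModuleCat.{u} A} [Module.Finite A X]
    (hX : IsIndecomposable X) {B B' : Type u} [AddCommGroup B] [Module A B]
    [AddCommGroup B'] [Module A B'] (φ : (X × B) ≃ₗ[A] (X × B')) : Nonempty (B ≃ₗ[A] B') := by
  let a : Module.End A X := LinearMap.fst A X B' ∘ₗ φ.toLinearMap ∘ₗ LinearMap.inl A X B
  let c : X →ₗ[A] B' := LinearMap.snd A X B' ∘ₗ φ.toLinearMap ∘ₗ LinearMap.inl A X B
  let a' : Module.End A X := LinearMap.fst A X B ∘ₗ φ.symm.toLinearMap ∘ₗ LinearMap.inl A X B'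
  let b' : B' →ₗ[A] X := LinearMap.fst A X B ∘ₗ φ.symm.toLinearMap ∘ₗ LinearMap.inr A X B'
  by_cases ha : IsUnit a
  · exact cancel_of_bijective φ ((Module.End.isUnit_iff _).1 ha)
  have hsum : a' * a + b' ∘ₗ c = 1 := by
    ext x
    have h1 : φ (x, 0) = (a x, 0) + (0, c x) := by
      change φ (x, 0) = ((φ (x, 0)).1, 0) + (0, (φ (x, 0)).2)
      simp
    have h2 : φ.symm ((a x, 0) + (0, c x)) = (x, 0) := by rw [← h1, φ.symm_apply_apply]
    rw [map_add] at h2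
    exact congrArg Prod.fst h2
  let v : Module.End A X := b' ∘ₗ c
  have hv : IsUnit v := by
    refine (hX.isUnit_or v).resolve_right fun h => ha ?_
    have h1 : 1 - v = a' * a := by rw [← hsum, add_sub_cancel_right]
    rw [h1, Module.End.isUnit_iff] at h
    have hinj : Function.Injective a := Function.Injective.of_comp (f := a') h.1
    exact (Module.End.isUnit_iff _).2 ⟨hinj, IsArtinian.surjective_of_injective_endomorphism a hinj⟩
  have hav : IsUnit (a + v) := by
    obtain ⟨w, hw⟩ := hv
    obtain h1 | h1 := hX.isUnit_or (-(↑w⁻¹ * a))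
    · exact absurd (by simpa using h1) ha
    · have : a + v = ↑w * (1 - -(↑w⁻¹ * a)) := by
        rw [sub_neg_eq_add, mul_add, Units.mul_inv_cancel_left, mul_one, hw, add_comm]
      rw [this]
      exact w.isUnit.mul h1
  -- The shear `(x, y) ↦ (x + b' y, y)`; the corner of `φ` followed by `σ` is `a + v`.
  let σ : (X × B') ≃ₗ[A] (X × B') := LinearEquiv.ofLinearMap
    ((LinearMap.fst A X B' + b' ∘ₗ LinearMap.snd A X B').prod (LinearMap.snd A X B'))
    ((LinearMap.fst A X B' - b' ∘ₗ LinearMap.snd A X B').prod (LinearMap.snd A X B'))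
    (by ext <;> simp) (by ext <;> simp)
  refine cancel_of_bijective (φ ≪≫ₗ σ) ?_
  convert! (Module.End.isUnit_iff _).1 hav using 1

/-- Modules of finite length cancel in direct sums. -/
theorem cancel_prod [IsArtinianRing A] (C : ModuleCat.{u} A) [Module.Finite A C]
    (B B' : ModuleCat.{u} A)
    (φ : (C × B) ≃ₗ[A] (C × B')) : Nonempty (B ≃ₗ[A] B') := by
  induction C using indecomposable_induction generalizing B B' with
  | zero C h =>
    have : Unique C := ⟨⟨0⟩, fun _ => Subsingleton.elim _ _⟩
    exact ⟨LinearEquiv.uniqueProd.symm ≪≫ₗ φ ≪≫ₗ LinearEquiv.uniqueProd⟩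
  | indecomposable C _ h => exact h.cancel φ
  | prod C C₁ C₂ _ e h₁ h₂ =>
    obtain ⟨ψ⟩ := h₁ (ModuleCat.of A (C₂ × B)) (ModuleCat.of A (C₂ × B'))
      ((LinearEquiv.prodAssoc A C₁ C₂ B).symm ≪≫ₗ
        (e.symm.prodCongr (LinearEquiv.refl A B)) ≪≫ₗ φ ≪≫ₗ
        (e.prodCongr (LinearEquiv.refl A B')) ≪≫ₗ LinearEquiv.prodAssoc A C₁ C₂ B')
    exact h₂ B B' ψ

end KrullSchmidt

end IgusaTodorov

noncomputable section

namespace IgusaTodorov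

/-! ### Stable isomorphism, equality in K₀ and the function φ. -/

section StableIso

variable {A : Type u} [Ring A]

/-! ### Stable isomorphism -/

/-- The map `h` factors through an injective module. -/
def FactorsInjective {M N : ModuleCat.{u} A} (h : M →ₗ[A] N) : Prop :=
  ∃ (J : ModuleCat.{u} A) (a : M →ₗ[A] J) (b : J →ₗ[A] N), Module.Injective A J ∧ b ∘ₗ a = h

/-- `M` and `N` are isomorphic modulo maps that factor through injective modules. -/
def StIso (M N : ModuleCat.{u} A) : Prop :=
  ∃ (f : M →ₗ[A] N) (g : N →ₗ[A] M), FactorsInjective (LinearMap.id - g ∘ₗ f) ∧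
    FactorsInjective (LinearMap.id - f ∘ₗ g)

theorem FactorsInjective.add {M N : ModuleCat.{u} A} {h h' : M →ₗ[A] N} (H : FactorsInjective h)
    (H' : FactorsInjective h') : FactorsInjective (h + h') := by
  obtain ⟨J, a, b, hJ, rfl⟩ := H
  obtain ⟨J', a', b', hJ', rfl⟩ := H'
  exact ⟨ModuleCat.of A (J × J'), a.prod a', b.coprod b', injective_prod hJ hJ',
    LinearMap.coprod_comp_prod _ _ _ _⟩

theorem FactorsInjective.comp_right {L M N : ModuleCat.{u} A} {h : M →ₗ[A] N}
    (H : FactorsInjective h) (k : L →ₗ[A] M) : FactorsInjective (h ∘ₗ k) := by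
  obtain ⟨J, a, b, hJ, rfl⟩ := H
  exact ⟨J, a ∘ₗ k, b, hJ, rfl⟩

theorem FactorsInjective.comp_left {L M N : ModuleCat.{u} A} {h : M →ₗ[A] N}
    (H : FactorsInjective h) (k : N →ₗ[A] L) : FactorsInjective (k ∘ₗ h) := by
  obtain ⟨J, a, b, hJ, rfl⟩ := H
  exact ⟨J, a, k ∘ₗ b, hJ, rfl⟩

theorem factorsInjective_zero (M N : ModuleCat.{u} A) :
    FactorsInjective (0 : M →ₗ[A] N) :=
  ⟨ModuleCat.of A PUnit, 0, 0, injective_of_subsingleton _, by simp⟩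

/-- A map that factors through an injective module factors through any embedding into an injective
module. -/
theorem FactorsInjective.exists_comp {M N E : ModuleCat.{u} A} {h : M →ₗ[A] N}
    (H : FactorsInjective h) (ι : M →ₗ[A] E) (hι : Function.Injective ι) :
    ∃ b : E →ₗ[A] N, b ∘ₗ ι = h := by
  obtain ⟨J, a, b, hJ, rfl⟩ := H
  obtain ⟨c, hc⟩ := exists_extend hJ ι hι a
  exact ⟨b ∘ₗ c, by rw [LinearMap.comp_assoc, hc]⟩

theorem StIso.of_equiv {M N : ModuleCat.{u} A} (e : M ≃ₗ[A] N) : StIso M N := by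
  refine ⟨e, e.symm, ?_, ?_⟩
  · convert! factorsInjective_zero M M using 1
    ext; simp
  · convert! factorsInjective_zero N N using 1
    ext; simp

theorem StIso.refl (M : ModuleCat.{u} A) : StIso M M := .of_equiv (LinearEquiv.refl A M)

theorem StIso.symm {M N : ModuleCat.{u} A} (h : StIso M N) : StIso N M := by
  obtain ⟨f, g, h₁, h₂⟩ := h
  exact ⟨g, f, h₂, h₁⟩

theorem StIso.trans {L M N : ModuleCat.{u} A} (h : StIso L M) (h' : StIso M N) : StIso L N := by
  obtain ⟨f, g, h₁, h₂⟩ := h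
  obtain ⟨f', g', h₁', h₂'⟩ := h'
  refine ⟨f' ∘ₗ f, g ∘ₗ g', ?_, ?_⟩
  · convert! h₁.add ((h₁'.comp_right f).comp_left g) using 1
    ext; simp
  · convert! h₂'.add ((h₂.comp_right g').comp_left f') using 1
    ext; simp

theorem StIso.prod {M N M' N' : ModuleCat.{u} A} (h : StIso M N) (h' : StIso M' N') :
    StIso (ModuleCat.of A (M × M')) (ModuleCat.of A (N × N')) := by
  obtain ⟨f, g, ⟨J, a, b, hJ, h₁⟩, ⟨K, c, d, hK, h₂⟩⟩ := h
  obtain ⟨f', g', ⟨J', a', b', hJ', h₁'⟩, ⟨K', c', d', hK', h₂'⟩⟩ := h'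
  refine ⟨f.prodMap f', g.prodMap g',
    ⟨ModuleCat.of A (J × J'), a.prodMap a', b.prodMap b', injective_prod hJ hJ', ?_⟩,
    ⟨ModuleCat.of A (K × K'), c.prodMap c', d.prodMap d', injective_prod hK hK', ?_⟩⟩
  · rw [LinearMap.prodMap_comp, h₁, h₁']
    ext <;> simp
  · rw [LinearMap.prodMap_comp, h₂, h₂']
    ext <;> simp

/-- In the `M`-corner of `φ⁻¹ φ = id`, the part not passing through `N` passes through the injective
module `J'`; symmetrically for `J`. -/
theorem StIso.of_prod_equiv {M N J J' : ModuleCat.{u} A} (hJ : Module.Injective A J)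
    (hJ' : Module.Injective A J') (φ : (M × J) ≃ₗ[A] (N × J')) : StIso M N := by
  have key : ∀ {M N J J' : ModuleCat.{u} A} (_ : Module.Injective A J')
      (φ : (M × J) ≃ₗ[A] (N × J')), FactorsInjective (LinearMap.id -
        (LinearMap.fst A M J ∘ₗ φ.symm.toLinearMap ∘ₗ LinearMap.inl A N J') ∘ₗ
        (LinearMap.fst A N J' ∘ₗ φ.toLinearMap ∘ₗ LinearMap.inl A M J)) := by
    intro M N J J' hJ' φ
    refine ⟨J', LinearMap.snd A N J' ∘ₗ φ.toLinearMap ∘ₗ LinearMap.inl A M J,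
      LinearMap.fst A M J ∘ₗ φ.symm.toLinearMap ∘ₗ LinearMap.inr A N J', hJ', ?_⟩
    ext x
    have h1 : φ.symm (((φ (x, 0)).1, 0) + (0, (φ (x, 0)).2)) = (x, 0) := by
      rw [Prod.mk_add_mk, add_zero, zero_add, Prod.mk.eta, φ.symm_apply_apply]
    rw [map_add] at h1
    have h2 := congrArg Prod.fst h1
    rw [Prod.fst_add] at h2
    exact eq_sub_of_add_eq' h2
  exact ⟨_, _, key hJ' φ, key hJ φ.symm⟩

/-- Stably isomorphic finitely generated modules become isomorphic after adding finitely generated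
injective modules. -/
theorem StIso.exists_prod_equiv [HasFiniteEnvelopes A] {M N : ModuleCat.{u} A} [Module.Finite A M]
    [Module.Finite A N] (h : StIso M N) :
    ∃ J J' : ModuleCat.{u} A, Module.Finite A J ∧ Module.Finite A J' ∧ Module.Injective A J ∧
      Module.Injective A J' ∧ Nonempty ((M × J) ≃ₗ[A] (N × J')) := by
  obtain ⟨f, g, h₁, h₂⟩ := h
  obtain ⟨E, ι, hι⟩ := exists_isInjectiveEnvelope M
  have hE : Module.Finite A E := HasFiniteEnvelopes.finite hι
  obtain ⟨b, hb⟩ := h₁.exists_comp ι hι.injective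
  -- Writing `id - g f = b ι` turns the stable splitting into an honest one: `M` is a summand of `N
  -- × E`.
  have hi : (g.coprod b) ∘ₗ (f.prod ι) = LinearMap.id := by
    rw [LinearMap.coprod_comp_prod, hb, add_sub_cancel]
  obtain ⟨K, s, t, hts, hti, ⟨e⟩⟩ := exists_compl_of_comp_eq_id (X := M)
    (M := ModuleCat.of A (N × E)) hi
  -- Since `t` kills the image of `(f, ι)`, for `s x = (n, e)` one has `x = t (n - f g n, e - ι g
  -- n)`. The first entry factors through an injective by `h₂`, the second through `E`, so the
  -- complement `K` is injective.
  have hK : FactorsInjective (LinearMap.id : K →ₗ[A] K) := by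
    have h3 : FactorsInjective (t ∘ₗ LinearMap.inr A N E ∘ₗ
        (LinearMap.snd A N E ∘ₗ s - ι ∘ₗ g ∘ₗ LinearMap.fst A N E ∘ₗ s)) :=
      ⟨E, LinearMap.snd A N E ∘ₗ s - ι ∘ₗ g ∘ₗ LinearMap.fst A N E ∘ₗ s,
        t ∘ₗ LinearMap.inr A N E, hι.injective_module, rfl⟩
    have h4 := ((h₂.comp_right (LinearMap.fst A N E ∘ₗ s)).comp_left
      (t ∘ₗ LinearMap.inl A N E)).add h3
    convert! h4 using 1
    ext x
    have e1 : t (s x) = x := LinearMap.congr_fun hts x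
    have e2 : t (f (g (s x).1), ι (g (s x).1)) = 0 := LinearMap.congr_fun hti (g (s x).1)
    have e3 : t ((s x).1 - f (g (s x).1), 0) + t (0, (s x).2 - ι (g (s x).1)) = x := by
      rw [← map_add, Prod.mk_add_mk, add_zero, zero_add, ← Prod.mk_sub_mk, map_sub, e2, sub_zero,
        Prod.mk.eta, e1]
    exact e3.symm
  obtain ⟨J, a, c, hJ, hac⟩ := hK
  have hNE : Module.Finite A (ModuleCat.of A (N × E)) := inferInstanceAs (Module.Finite A (N × E))
  exact ⟨K, E, Module.Finite.of_surjective t fun x => ⟨s x, LinearMap.congr_fun hts x⟩, hE,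
    (isSummand_iff.2 ⟨a, c, hac⟩).injective hJ, hι.injective_module, ⟨e.symm⟩⟩

/-- After adding injectives the stable isomorphism becomes an actual one, from which the module `C`
of finite length cancels. -/
theorem StIso.cancel [HasFiniteEnvelopes A] {M N C : ModuleCat.{u} A} [Module.Finite A M]
    [Module.Finite A N] [Module.Finite A C]
    (h : StIso (ModuleCat.of A (C × M)) (ModuleCat.of A (C × N))) : StIso M N := by
  have : Module.Finite A (ModuleCat.of A (C × M)) := inferInstanceAs (Module.Finite A (C × M))
  have : Module.Finite A (ModuleCat.of A (C × N)) := inferInstanceAs (Module.Finite A (C × N))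
  obtain ⟨J, J', -, -, hJ, hJ', ⟨φ⟩⟩ := h.exists_prod_equiv
  obtain ⟨ψ⟩ := cancel_prod C (ModuleCat.of A (M × J)) (ModuleCat.of A (N × J'))
    ((LinearEquiv.prodAssoc A C M J).symm ≪≫ₗ φ ≪≫ₗ LinearEquiv.prodAssoc A C N J')
  exact .of_prod_equiv hJ hJ' ψ

/-- The cosyzygy reflects stable isomorphisms between the `s`-th cosyzygies of modules in
`add Y`. -/
def CosyzygyReflectsStIso (s : ℕ) (Y : ModuleCat.{u} A) : Prop :=
  ∀ ⦃B C M N M' N' : ModuleCat.{u} A⦄, InAdd B Y → InAdd C Y → IsNthCosyzygy s B M →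
    IsNthCosyzygy s C N → IsCosyzygy M M' → IsCosyzygy N N' → StIso M' N' → StIso M N

/-! ### The group `K₀` -/

theorem K0.mk_eq_add {C B B' : FGModuleCat.{u} A} (e : C ≃ₗ[A] (B × B')) :
    K0.mk C = K0.mk B + K0.mk B' := by
  refine (QuotientAddGroup.eq_iff_sub_mem).2 (AddSubgroup.subset_closure (.inl ?_))
  exact ⟨B, B', C, ⟨e⟩, rfl⟩

theorem K0.mk_eq_zero {J : FGModuleCat.{u} A} (hJ : Module.Injective A J) : K0.mk J = 0 :=
  (QuotientAddGroup.eq_zero_iff _).2 (AddSubgroup.subset_closure (.inr ⟨J, hJ, rfl⟩))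

variable (A) in
/-- Stable isomorphism of finitely generated modules. -/
def stableSetoid : Setoid (FGModuleCat.{u} A) where
  r M N := StIso M.obj N.obj
  iseqv := ⟨fun M => .refl M.obj, .symm, .trans⟩

variable (A) in
/-- Stable isomorphism classes of finitely generated modules. -/
def StableClass : Type (u + 1) := Quotient (stableSetoid A)

namespace StableClass

/-- The stable isomorphism class of a finitely generated module. -/
def mk (M : FGModuleCat.{u} A) : StableClass A := Quotient.mk (stableSetoid A) M

theorem mk_eq_mk_iff {M N : FGModuleCat.{u} A} : mk M = mk N ↔ StIso M.obj N.obj :=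
  Quotient.eq (r := stableSetoid A)

theorem mk_eq_of_equiv {M N : FGModuleCat.{u} A} (e : M ≃ₗ[A] N) : mk M = mk N :=
  mk_eq_mk_iff.2 (.of_equiv e)

instance : Add (StableClass A) where
  add := Quotient.map₂ (fun M N => FGModuleCat.of A (M × N)) fun _ _ h _ _ h' => h.prod h'

instance : Zero (StableClass A) where
  zero := mk (FGModuleCat.of A PUnit)

theorem mk_eq_zero {J : FGModuleCat.{u} A} (hJ : Module.Injective A J) : mk J = 0 :=
  mk_eq_mk_iff.2 (.of_prod_equiv (J := ModuleCat.of A PUnit) (J' := J.obj)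
    (injective_of_subsingleton _) hJ (LinearEquiv.prodComm A _ _))

instance : AddCommMonoid (StableClass A) where
  add_assoc := by
    rintro ⟨M⟩ ⟨N⟩ ⟨L⟩
    exact mk_eq_of_equiv (LinearEquiv.prodAssoc A M N L)
  zero_add := by
    rintro ⟨M⟩
    exact mk_eq_of_equiv (M := FGModuleCat.of A (PUnit.{u + 1} × M)) LinearEquiv.uniqueProd
  add_zero := by
    rintro ⟨M⟩
    exact mk_eq_of_equiv (M := FGModuleCat.of A (M × PUnit.{u + 1})) LinearEquiv.prodUnique
  add_comm := by
    rintro ⟨M⟩ ⟨N⟩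
    exact mk_eq_of_equiv (LinearEquiv.prodComm A M N)
  nsmul := nsmulRec

/-- Cancellation is what makes the monoid of stable classes embed into its group completion. -/
instance [HasFiniteEnvelopes A] : IsCancelAdd (StableClass A) :=
  have : IsLeftCancelAdd (StableClass A) := ⟨by
    rintro ⟨C⟩ ⟨M⟩ ⟨N⟩ h
    exact mk_eq_mk_iff.2 ((mk_eq_mk_iff.1 h).cancel (C := C.obj))⟩
  AddCommMagma.IsLeftCancelAdd.toIsCancelAdd _

end StableClass

variable (A) in
/-- The homomorphism from `K₀` to the group completion of the stable isomorphism classes. -/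
def K0.toStable : K0 A →+ Algebra.GrothendieckAddGroup (StableClass A) :=
  QuotientAddGroup.lift (k0Relations A)
    (FreeAbelianGroup.lift fun M => Algebra.GrothendieckAddGroup.of (StableClass.mk M)) <| by
    rw [k0Relations, AddSubgroup.closure_le]
    rintro x (⟨M, N, C, ⟨e⟩, rfl⟩ | ⟨J, hJ, rfl⟩)
    · have h : StableClass.mk C = StableClass.mk M + StableClass.mk N :=
        StableClass.mk_eq_of_equiv (N := FGModuleCat.of A (M × N)) e
      simp only [SetLike.mem_coe, AddMonoidHom.mem_ker, map_sub, map_add,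
        FreeAbelianGroup.lift_apply_of, h, sub_self]
    · simp only [SetLike.mem_coe, AddMonoidHom.mem_ker, FreeAbelianGroup.lift_apply_of,
        StableClass.mk_eq_zero hJ, map_zero]

theorem K0.toStable_mk (M : FGModuleCat.{u} A) :
    K0.toStable A (K0.mk M) = Algebra.GrothendieckAddGroup.of (StableClass.mk M) :=
  FreeAbelianGroup.lift_apply_of _ _

variable [HasFiniteEnvelopes A]

/-- Equality in `K₀` is detected in the group completion of the stable classes, into which these
inject. Conversely, stable isomorphism becomes isomorphism after adding injectives, whose classes
vanish. -/
theorem K0.mk_eq_mk_iff {M N : FGModuleCat.{u} A} :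
    K0.mk M = K0.mk N ↔ StIso M.obj N.obj := by
  constructor
  · intro h
    have h' := congrArg (K0.toStable A) h
    rw [K0.toStable_mk, K0.toStable_mk] at h'
    exact StableClass.mk_eq_mk_iff.1 (Algebra.GrothendieckAddGroup.of_injective h')
  · intro h
    have : Module.Finite A M.obj := inferInstanceAs (Module.Finite A M)
    have : Module.Finite A N.obj := inferInstanceAs (Module.Finite A N)
    obtain ⟨J, J', hJ, hJ', hiJ, hiJ', ⟨e⟩⟩ := h.exists_prod_equiv
    have h1 := K0.mk_eq_add (C := FGModuleCat.of A (M.obj × J)) (B := M) (B' := FGModuleCat.of A J)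
      (LinearEquiv.refl A _)
    have h2 := K0.mk_eq_add (C := FGModuleCat.of A (M.obj × J)) (B := N)
      (B' := FGModuleCat.of A J') e
    rw [K0.mk_eq_zero (J := FGModuleCat.of A J) hiJ, add_zero] at h1
    rw [K0.mk_eq_zero (J := FGModuleCat.of A J') hiJ', add_zero] at h2
    exact h1.symm.trans h2

theorem exists_fg_isCosyzygy (M : FGModuleCat.{u} A) :
    ∃ N : FGModuleCat.{u} A, IsCosyzygy M.obj N.obj := by
  obtain ⟨N, hN⟩ := exists_isCosyzygy M.obj
  have : Module.Finite A M.obj := inferInstanceAs (Module.Finite A M)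
  have := hN.finite
  exact ⟨FGModuleCat.of A N, hN⟩

variable (A) in
-- Cosyzygies are unique, additive, and zero on injectives, so the relations are respected. Hence
-- `cosyzygyHom` is not the default value zero.
theorem exists_cosyzygyHom : ∃ f : K0 A →+ K0 A, ∀ M N : FGModuleCat.{u} A,
    IsCosyzygy M.obj N.obj → f (K0.mk M) = K0.mk N := by
  choose c hc using exists_fg_isCosyzygy (A := A)
  have huniq : ∀ {M N : FGModuleCat.{u} A}, IsCosyzygy M.obj N.obj → K0.mk (c M) = K0.mk N := by
    intro M N h
    obtain ⟨e⟩ := (hc M).unique (LinearEquiv.refl A _) h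
    exact K0.mk_eq_mk_iff.2 (.of_equiv e)
  refine ⟨QuotientAddGroup.lift (k0Relations A) (FreeAbelianGroup.lift fun M => K0.mk (c M)) ?_,
    fun M N h => (FreeAbelianGroup.lift_apply_of _ _).trans (huniq h)⟩
  refine (AddSubgroup.closure_le _).2 ?_
  rintro x (⟨M, N, C, ⟨e⟩, rfl⟩ | ⟨J, hJ, rfl⟩)
  · have h1 : IsCosyzygy C.obj (FGModuleCat.of A (c M × c N)).obj :=
      ((hc M).prod (hc N)).congr e.symm (LinearEquiv.refl A _)
    have h2 := K0.mk_eq_add (C := FGModuleCat.of A (c M × c N)) (LinearEquiv.refl A _)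
    simp only [SetLike.mem_coe, AddMonoidHom.mem_ker, map_sub, map_add,
      FreeAbelianGroup.lift_apply_of, huniq h1, h2, sub_self]
  · have : Subsingleton (c J) := (hc J).subsingleton hJ
    simp only [SetLike.mem_coe, AddMonoidHom.mem_ker, FreeAbelianGroup.lift_apply_of]
    exact K0.mk_eq_zero (injective_of_subsingleton (c J).obj)

theorem cosyzygyHom_mk {M N : FGModuleCat.{u} A} (h : IsCosyzygy M.obj N.obj) :
    cosyzygyHom A (K0.mk M) = K0.mk N := by
  rw [cosyzygyHom, dif_pos (exists_cosyzygyHom A)]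
  exact (exists_cosyzygyHom A).choose_spec M N h

/-! ### The function `φ_r` -/

/-- Passes from indecomposable generators to differences of classes in add Y: a module in add Y
decomposes into indecomposables, each of which is a summand of `Y` itself. -/
theorem mem_addSubgroup_iff {Y : ModuleCat.{u} A} {x : K0 A} :
    x ∈ addSubgroup Y ↔ ∃ B C : FGModuleCat.{u} A, InAdd B.obj Y ∧ InAdd C.obj Y ∧
      x = K0.mk B - K0.mk C := by
  have hzero : K0.mk (FGModuleCat.of A PUnit) = 0 :=
    K0.mk_eq_zero (injective_of_subsingleton (ModuleCat.of A PUnit))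
  have hadd0 : InAdd (FGModuleCat.of A PUnit).obj Y :=
    ⟨0, isSummand_iff.2 ⟨0, 0, by ext⟩⟩
  have hmem : ∀ (B : ModuleCat.{u} A) [Module.Finite A B], InAdd B Y →
      K0.mk (FGModuleCat.of A B) ∈ addSubgroup Y := by
    intro B hB
    refine indecomposable_induction (P := fun B => ∀ h : Module.Finite A B, InAdd B Y →
      K0.mk (FGModuleCat.of A B) ∈ addSubgroup Y) ?_ ?_ ?_ B hB
    · intro C h _ _
      rw [K0.mk_eq_zero (injective_of_subsingleton C)]
      exact zero_mem _
    · intro C _ h _ hCY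
      exact AddSubgroup.subset_closure ⟨_, h, h.isSummand hCY, rfl⟩
    · intro C C₁ C₂ _ e h₁ h₂ _ hCY
      have := finite_prod_left e
      have := finite_prod_right e
      rw [K0.mk_eq_add (C := FGModuleCat.of A C) (B := FGModuleCat.of A C₁)
        (B' := FGModuleCat.of A C₂) e]
      exact add_mem
        (h₁ _ (.of_summand ((isSummand_prod_left C₁ C₂).trans (isSummand_of_equiv e.symm)) hCY))
        (h₂ _ (.of_summand ((isSummand_prod_right C₁ C₂).trans (isSummand_of_equiv e.symm)) hCY))
  constructor
  · intro hx
    induction hx using AddSubgroup.closure_induction with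
    | mem x hx =>
      obtain ⟨X, -, hX, rfl⟩ := hx
      exact ⟨X, FGModuleCat.of A PUnit, .of_isSummand hX, hadd0, by rw [hzero, sub_zero]⟩
    | zero => exact ⟨_, _, hadd0, hadd0, (sub_self _).symm⟩
    | add x y _ _ hx hy =>
      obtain ⟨B, C, hB, hC, rfl⟩ := hx
      obtain ⟨B', C', hB', hC', rfl⟩ := hy
      refine ⟨FGModuleCat.of A (B × B'), FGModuleCat.of A (C × C'), hB.prod hB', hC.prod hC', ?_⟩
      rw [K0.mk_eq_add (C := FGModuleCat.of A (B × B')) (LinearEquiv.refl A _),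
        K0.mk_eq_add (C := FGModuleCat.of A (C × C')) (LinearEquiv.refl A _)]
      abel
    | neg x _ hx =>
      obtain ⟨B, C, hB, hC, rfl⟩ := hx
      exact ⟨C, B, hC, hB, by abel⟩
  · rintro ⟨B, C, hB, hC, rfl⟩
    exact sub_mem (hmem B.obj hB) (hmem C.obj hC)

theorem mem_cosyzygySubgroup_iff {Y : ModuleCat.{u} A} {s : ℕ} {x : K0 A} :
    x ∈ cosyzygySubgroup Y s ↔ ∃ B C M N : FGModuleCat.{u} A, InAdd B.obj Y ∧ InAdd C.obj Y ∧
      IsNthCosyzygy s B.obj M.obj ∧ IsNthCosyzygy s C.obj N.obj ∧ x = K0.mk M - K0.mk N := by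
  induction s generalizing x with
  | zero =>
    refine mem_addSubgroup_iff.trans ⟨?_, ?_⟩
    · rintro ⟨B, C, hB, hC, rfl⟩
      exact ⟨B, C, B, C, hB, hC, .refl _, .refl _, rfl⟩
    · rintro ⟨B, C, M, N, hB, hC, hM, hN, rfl⟩
      obtain ⟨e⟩ := isNthCosyzygy_zero_iff.1 hM
      obtain ⟨e'⟩ := isNthCosyzygy_zero_iff.1 hN
      exact ⟨M, N, hB.of_summand (isSummand_of_equiv e.symm),
        hC.of_summand (isSummand_of_equiv e'.symm), rfl⟩
  | succ s ih =>
    change x ∈ (cosyzygySubgroup Y s).map (cosyzygyHom A) ↔ _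
    rw [AddSubgroup.mem_map]
    constructor
    · rintro ⟨y, hy, rfl⟩
      obtain ⟨B, C, M, N, hB, hC, hM, hN, rfl⟩ := ih.1 hy
      obtain ⟨M', hM'⟩ := exists_fg_isCosyzygy M
      obtain ⟨N', hN'⟩ := exists_fg_isCosyzygy N
      exact ⟨B, C, M', N', hB, hC, hM.succ hM', hN.succ hN', by
        rw [map_sub, cosyzygyHom_mk hM', cosyzygyHom_mk hN']⟩
    · rintro ⟨B, C, M', N', hB, hC, ⟨M, hM, hM'⟩, ⟨N, hN, hN'⟩, rfl⟩
      have : Module.Finite A B.obj := inferInstanceAs (Module.Finite A B)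
      have : Module.Finite A C.obj := inferInstanceAs (Module.Finite A C)
      have := hM.finite
      have := hN.finite
      refine ⟨K0.mk (FGModuleCat.of A M) - K0.mk (FGModuleCat.of A N),
        ih.2 ⟨B, C, _, _, hB, hC, hM, hN, rfl⟩, ?_⟩
      rw [map_sub, cosyzygyHom_mk (M := FGModuleCat.of A M) hM',
        cosyzygyHom_mk (M := FGModuleCat.of A N) hN']

/-- Surjectivity is automatic, the target being the image. Injectivity on a subgroup is triviality
of the kernel, and its elements are differences of classes. -/
theorem bijOn_cosyzygyHom_iff {Y : ModuleCat.{u} A} [Module.Finite A Y] {s : ℕ} :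
    Set.BijOn (cosyzygyHom A) (cosyzygySubgroup Y s) (cosyzygySubgroup Y (s + 1)) ↔
      CosyzygyReflectsStIso s Y := by
  constructor
  · intro h B C M N M' N' hB hC hM hN hM' hN' hst
    have := hB.finite
    have := hC.finite
    have := hM.finite
    have := hN.finite
    have := hM'.finite
    have := hN'.finite
    have hmem : K0.mk (FGModuleCat.of A M) - K0.mk (FGModuleCat.of A N) ∈ cosyzygySubgroup Y s :=
      mem_cosyzygySubgroup_iff.2 ⟨FGModuleCat.of A B, FGModuleCat.of A C, _, _, hB, hC, hM, hN, rfl⟩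
    have h0 : cosyzygyHom A (K0.mk (FGModuleCat.of A M) - K0.mk (FGModuleCat.of A N)) =
        cosyzygyHom A 0 := by
      rw [map_sub, map_zero, cosyzygyHom_mk (M := FGModuleCat.of A M) (N := FGModuleCat.of A M') hM',
        cosyzygyHom_mk (M := FGModuleCat.of A N) (N := FGModuleCat.of A N') hN', sub_eq_zero]
      exact K0.mk_eq_mk_iff.2 hst
    exact K0.mk_eq_mk_iff.1 (sub_eq_zero.1 (h.injOn hmem (zero_mem _) h0))
  · intro h
    refine ⟨fun x hx => AddSubgroup.mem_map_of_mem _ hx, fun x hx y hy hxy => ?_, fun x hx => hx⟩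
    rw [← sub_eq_zero] at hxy ⊢
    rw [← map_sub] at hxy
    obtain ⟨B, C, M, N, hB, hC, hM, hN, hMN⟩ := mem_cosyzygySubgroup_iff.1 (sub_mem hx hy)
    rw [hMN] at hxy ⊢
    obtain ⟨M', hM'⟩ := exists_fg_isCosyzygy M
    obtain ⟨N', hN'⟩ := exists_fg_isCosyzygy N
    rw [map_sub, cosyzygyHom_mk hM', cosyzygyHom_mk hN', sub_eq_zero] at hxy
    rw [sub_eq_zero]
    exact K0.mk_eq_mk_iff.2 (h hB hC hM hN hM' hN' (K0.mk_eq_mk_iff.1 hxy))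

theorem phiR_eq_sInf (Y : ModuleCat.{u} A) [Module.Finite A Y] :
    phiR Y = sInf {n | ∀ s, n ≤ s → CosyzygyReflectsStIso s Y} := by
  simp only [phiR, bijOn_cosyzygyHom_iff]

end StableIso

end IgusaTodorov

end

noncomputable section

namespace IgusaTodorov

/-! ### Ext functors, stable isomorphism and injective dimension. -/

section ExtFunctors

open Abelian Opposite

variable {A : Type u} [Ring A]

/-! ### The functors `Ext^d(-, X)` -/

theorem extInto_naturality {d d' : ℕ} {X X' : ModuleCat.{u} A} (η : extInto d X ⟶ extInto d' X')
    {M N : FGModuleCat.{u} A} (f : M.obj ⟶ N.obj) (α : Ext.{u} N.obj X d) :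
    (η.app (op M)).hom ((Ext.mk₀ f).comp α (zero_add d)) =
      (Ext.mk₀ f).comp (show Ext.{u} N.obj X' d' from (η.app (op N)).hom α) (zero_add d') :=
  congrArg (fun k => k.hom α) (η.naturality (ObjectProperty.homMk f : M ⟶ N).op)

/-- The isomorphism of functors induced by an isomorphism. -/
def extIntoIso (d : ℕ) {X X' : ModuleCat.{u} A} (e : X ≅ X') : extInto d X ≅ extInto d X' :=
  Functor.isoWhiskerLeft _ ((extFunctor d).flip.mapIso e)

/-- The transformation of functors induced by a homomorphism. -/
def extIntoMap (d : ℕ) {X X' : ModuleCat.{u} A} (f : X ⟶ X') : extInto d X ⟶ extInto d X' :=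
  Functor.whiskerLeft _ ((extFunctor d).flip.map f)

/-- Long exact sequence: the positive Ext groups into the injective middle term vanish. -/
theorem extClass_postcomp_bijective {S : ShortComplex (ModuleCat.{u} A)} (hS : S.ShortExact)
    (hE : Injective S.X₂) (d : ℕ) (M : ModuleCat.{u} A) :
    Function.Bijective (hS.extClass.postcomp M (rfl : d + 1 + 1 = d + 2)) := by
  constructor
  · rw [injective_iff_map_eq_zero]
    intro α hα
    obtain ⟨β, rfl⟩ := Ext.covariant_sequence_exact₃ M hS α rfl hα
    rw [β.eq_zero_of_injective, Ext.zero_comp]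
  · intro α
    exact Ext.covariant_sequence_exact₁ M hS α (Ext.eq_zero_of_injective _) rfl

/-- Dimension shift. -/
def extIntoShift {S : ShortComplex (ModuleCat.{u} A)} (hS : S.ShortExact)
    (hE : Injective S.X₂) (d : ℕ) : extInto (d + 1) S.X₃ ≅ extInto (d + 2) S.X₁ :=
  NatIso.ofComponents (fun M => AddEquiv.toAddCommGrpIso
    (AddEquiv.ofBijective _ (extClass_postcomp_bijective hS hE d M.unop.obj))) (by
    intro M N f
    ext α
    exact Ext.comp_assoc (Ext.mk₀ f.unop.hom) (show Ext.{u} M.unop.obj S.X₃ (d + 1) from α)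
      hS.extClass (zero_add _) rfl (by lia))

theorem shortExact_of_exact {M E N : ModuleCat.{u} A} {f : M →ₗ[A] E} {g : E →ₗ[A] N}
    (hf : Function.Injective f) (hfg : Function.Exact f g) (hg : Function.Surjective g) :
    ∃ w, (ShortComplex.mk (ModuleCat.ofHom f) (ModuleCat.ofHom g) w).ShortExact := by
  have w : ModuleCat.ofHom f ≫ ModuleCat.ofHom g = 0 := by
    rw [← ModuleCat.ofHom_comp, hfg.linearMap_comp_eq_zero]; rfl
  exact ⟨w, { exact := (ShortComplex.ShortExact.moduleCat_exact_iff_function_exact _).2 hfg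
              mono_f := (ModuleCat.mono_iff_injective _).2 hf
              epi_g := (ModuleCat.epi_iff_surjective _).2 hg }⟩

theorem injective_object {J : ModuleCat.{u} A} (h : Module.Injective A J) : Injective J :=
  (Module.injective_iff_injective_object A J).1 h

theorem IsNthCosyzygy.nonempty_extInto_iso {n : ℕ} {X N : ModuleCat.{u} A}
    (h : IsNthCosyzygy n X N) (j : ℕ) :
    Nonempty (extInto (j + 1) N ≅ extInto (n + (j + 1)) X) := by
  induction n generalizing N j with
  | zero =>
    obtain ⟨e⟩ := h
    rw [zero_add]
    exact ⟨extIntoIso _ e.symm⟩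
  | succ n ih =>
    obtain ⟨K, hK, E, f, g, hf, hfg, hg⟩ := h
    obtain ⟨w, hS⟩ := shortExact_of_exact hf.injective hfg hg
    obtain ⟨e⟩ := ih hK (j + 1)
    rw [show n + 1 + (j + 1) = n + (j + 1 + 1) by lia]
    exact ⟨extIntoShift hS (injective_object hf.injective_module) j ≪≫ e⟩

theorem FactorsInjective.ext_comp_eq_zero {X X' : ModuleCat.{u} A} {h : X →ₗ[A] X'}
    (H : FactorsInjective h) {M : ModuleCat.{u} A} {d : ℕ} (α : Ext.{u} M X (d + 1)) :
    α.comp (Ext.mk₀ (ModuleCat.ofHom h)) (add_zero _) = 0 := by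
  obtain ⟨J, a, b, hJ, rfl⟩ := H
  have := injective_object hJ
  rw [ModuleCat.ofHom_comp, ← Ext.mk₀_comp_mk₀, ← Ext.comp_assoc_of_third_deg_zero,
    (α.comp (Ext.mk₀ (ModuleCat.ofHom a)) (add_zero _)).eq_zero_of_injective, Ext.zero_comp]

theorem StIso.nonempty_extInto_iso {X X' : ModuleCat.{u} A} (h : StIso X X') (d : ℕ) :
    Nonempty (extInto (d + 1) X ≅ extInto (d + 1) X') := by
  have key : ∀ {X X' : ModuleCat.{u} A} (f : X →ₗ[A] X') (g : X' →ₗ[A] X),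
      FactorsInjective (LinearMap.id - g ∘ₗ f) →
      extIntoMap (d + 1) (ModuleCat.ofHom f) ≫ extIntoMap (d + 1) (ModuleCat.ofHom g) = 𝟙 _ := by
    intro X X' f g H
    ext M α
    have h1 := H.ext_comp_eq_zero (show Ext.{u} M.unop.obj X (d + 1) from α)
    rw [show ModuleCat.ofHom (LinearMap.id - g ∘ₗ f) =
        𝟙 X - ModuleCat.ofHom f ≫ ModuleCat.ofHom g from rfl, sub_eq_add_neg, Ext.mk₀_add,
      Ext.mk₀_neg, Ext.comp_add, Ext.comp_neg, Ext.comp_mk₀_id, ← Ext.mk₀_comp_mk₀,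
      ← Ext.comp_assoc_of_third_deg_zero, ← sub_eq_add_neg, sub_eq_zero] at h1
    exact h1.symm
  obtain ⟨f, g, h₁, h₂⟩ := h
  exact ⟨⟨extIntoMap _ (ModuleCat.ofHom f), extIntoMap _ (ModuleCat.ofHom g), key f g h₁,
    key g f h₂⟩⟩

/-- A transformation `Ext¹(-, X) → Ext¹(-, X')` is induced by a map `X → X'`. -/
theorem exists_extIntoMap_eq {X E C : ModuleCat.{u} A} [Module.Finite A E] [Module.Finite A C]
    {f : X ⟶ E} {g : E ⟶ C} {w : f ≫ g = 0} (hS : (ShortComplex.mk f g w).ShortExact)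
    [Injective E] {X' : ModuleCat.{u} A} (η : extInto 1 X ⟶ extInto 1 X') :
    ∃ φ : X ⟶ X', η = extIntoMap 1 φ := by
  let E' : FGModuleCat.{u} A := FGModuleCat.of A E
  let C' : FGModuleCat.{u} A := FGModuleCat.of A C
  let ξ : Ext.{u} C X 1 := hS.extClass
  -- The class `ξ` of the sequence is universal: each element of `Ext¹(M, X)` is a pullback of `ξ`
  -- along some `M → C`, so `η` is determined by `ζ`. The pullback of `ζ` to `E` vanishes, so `ζ` is
  -- a pushout of `ξ` along some `φ`.
  let ζ : Ext.{u} C X' 1 := (η.app (op C')).hom ξ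
  have h0 : (Ext.mk₀ g).comp ζ (zero_add 1) = 0 := by
    have h1 := extInto_naturality η (M := E') (N := C') g ξ
    have h2 : (Ext.mk₀ g).comp ξ (zero_add 1) = 0 := hS.comp_extClass
    rw [h2] at h1
    exact h1.symm.trans (map_zero _)
  obtain ⟨x, hx⟩ := Ext.contravariant_sequence_exact₃ hS X' ζ h0 (add_zero 1)
  obtain ⟨φ, rfl⟩ := Ext.homEquiv₀.symm.surjective x
  refine ⟨φ, ?_⟩
  ext M α
  obtain ⟨y, hy⟩ := Ext.covariant_sequence_exact₁ M.unop.obj hS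
    (show Ext.{u} M.unop.obj X 1 from α) (Ext.eq_zero_of_injective _) (zero_add 1)
  obtain ⟨a, rfl⟩ := Ext.homEquiv₀.symm.surjective y
  have h1 := extInto_naturality η (M := M.unop) (N := C') a ξ
  have h2 : (Ext.mk₀ a).comp ξ (zero_add 1) = α := hy
  rw [h2] at h1
  refine h1.trans ?_
  change (Ext.mk₀ a).comp ζ (zero_add 1) = Ext.comp α (Ext.mk₀ φ) (add_zero 1)
  rw [← h2, ← hx]
  exact (Ext.comp_assoc_of_third_deg_zero _ _ _ _).symm

/-- The two directions of `η` come from maps `φ`, `ψ`. An endomorphism `θ` acting as the identity on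
`Ext¹` fixes the class of `0 → X → E → C → 0`, so `id - θ` kills it and hence extends over `E`. -/
theorem stIso_of_extInto_iso [HasFiniteEnvelopes A] {X X' : ModuleCat.{u} A} [Module.Finite A X]
    [Module.Finite A X'] (η : extInto 1 X ≅ extInto 1 X') : StIso X X' := by
  have key : ∀ {X : ModuleCat.{u} A} [Module.Finite A X],
      (∀ {X' : ModuleCat.{u} A} (η : extInto 1 X ⟶ extInto 1 X'), ∃ φ : X ⟶ X',
        η = extIntoMap 1 φ) ∧
      ∀ θ : X ⟶ X, extIntoMap 1 θ = 𝟙 _ →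
        FactorsInjective ((LinearMap.id : X →ₗ[A] X) - θ.hom) := by
    intro X _
    obtain ⟨E, f, hf⟩ := exists_isInjectiveEnvelope X
    have := HasFiniteEnvelopes.finite hf
    let C := ModuleCat.of A (E ⧸ LinearMap.range f)
    have : Module.Finite A C := inferInstanceAs (Module.Finite A (E ⧸ LinearMap.range f))
    obtain ⟨w, hS⟩ := shortExact_of_exact (N := C) hf.injective
      (LinearMap.exact_map_mkQ_range f) (Submodule.mkQ_surjective _)
    have := injective_object hf.injective_module
    refine ⟨fun η => exists_extIntoMap_eq hS η, fun θ hθ => ?_⟩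
    have h1 : hS.extClass.comp (Ext.mk₀ θ) (add_zero 1) = hS.extClass :=
      congrArg (fun k : extInto 1 X ⟶ extInto 1 X =>
        (k.app (op (FGModuleCat.of A C))).hom hS.extClass) hθ
    have h2 : hS.extClass.comp (Ext.mk₀ (𝟙 X - θ)) (add_zero 1) = 0 := by
      rw [sub_eq_add_neg, Ext.mk₀_add, Ext.mk₀_neg, Ext.comp_add, Ext.comp_neg, h1]
      exact (congrArg (· + -hS.extClass) (Ext.comp_mk₀_id _)).trans (add_neg_cancel _)
    obtain ⟨x, hx⟩ := Ext.contravariant_sequence_exact₁ hS X _ (add_zero 1) h2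
    obtain ⟨b, rfl⟩ := Ext.homEquiv₀.symm.surjective x
    have h3 : ModuleCat.ofHom f ≫ b = 𝟙 X - θ := by
      apply Ext.homEquiv₀.symm.injective
      simpa using hx
    exact ⟨E, f, b.hom, hf.injective_module, congrArg ModuleCat.Hom.hom h3⟩
  obtain ⟨φ, hφ⟩ := key.1 η.hom
  obtain ⟨ψ, hψ⟩ := key.1 η.inv
  have hcomp : ∀ {L M N : ModuleCat.{u} A} (f : L ⟶ M) (g : M ⟶ N),
      extIntoMap 1 (f ≫ g) = extIntoMap 1 f ≫ extIntoMap 1 g := fun f g => by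
    rw [extIntoMap, Functor.map_comp, Functor.whiskerLeft_comp]; rfl
  exact ⟨φ.hom, ψ.hom, key.2 (φ ≫ ψ) (by rw [hcomp, ← hφ, ← hψ, η.hom_inv_id]),
    key.2 (ψ ≫ φ) (by rw [hcomp, ← hφ, ← hψ, η.inv_hom_id])⟩

/-- The functor `Ext^{d+1}(-, X)` determines the stable isomorphism class of the `d`-th cosyzygy. -/
theorem nonempty_extInto_succ_iso_iff [HasFiniteEnvelopes A] {d : ℕ} {X X' N N' : ModuleCat.{u} A}
    [Module.Finite A X] [Module.Finite A X'] (h : IsNthCosyzygy d X N)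
    (h' : IsNthCosyzygy d X' N') :
    Nonempty (extInto (d + 1) X ≅ extInto (d + 1) X') ↔ StIso N N' := by
  have := h.finite
  have := h'.finite
  obtain ⟨e⟩ := h.nonempty_extInto_iso 0
  obtain ⟨e'⟩ := h'.nonempty_extInto_iso 0
  constructor
  · rintro ⟨η⟩
    exact stIso_of_extInto_iso (e ≪≫ η ≪≫ e'.symm)
  · intro hst
    obtain ⟨η⟩ := hst.nonempty_extInto_iso 0
    exact ⟨e.symm ≪≫ η ≪≫ e'⟩

/-- Yoneda, available on finitely generated modules because `X` and `X'` are themselves finitely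
generated. -/
theorem nonempty_extInto_zero_iso_iff {X X' : ModuleCat.{u} A} [Module.Finite A X]
    [Module.Finite A X'] :
    Nonempty (extInto 0 X ≅ extInto 0 X') ↔ Nonempty (X ≃ₗ[A] X') := by
  constructor
  · rintro ⟨η⟩
    have key : ∀ {X X' : ModuleCat.{u} A} [Module.Finite A X] (η : extInto 0 X ⟶ extInto 0 X'),
        ∃ φ : X ⟶ X', ∀ (M : FGModuleCat.{u} A) (a : M.obj ⟶ X),
          (η.app (op M)).hom (Ext.mk₀ a) = Ext.mk₀ (a ≫ φ) := by
      intro X X' _ η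
      obtain ⟨φ, hφ⟩ := Ext.homEquiv₀.symm.surjective (show Ext.{u} X X' 0 from
        (η.app (op (FGModuleCat.of A X))).hom (Ext.mk₀ (𝟙 X)))
      refine ⟨φ, fun M a => ?_⟩
      have h1 := extInto_naturality η (M := M) (N := FGModuleCat.of A X) a (Ext.mk₀ (𝟙 X))
      have h2 : (Ext.mk₀ a).comp (Ext.mk₀ (𝟙 X)) (zero_add 0) = Ext.mk₀ a := Ext.comp_mk₀_id _
      rw [h2] at h1
      refine h1.trans ?_
      rw [← Ext.mk₀_comp_mk₀]
      exact congrArg (fun β => (Ext.mk₀ a).comp β (zero_add 0)) hφ.symm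
    obtain ⟨φ, hφ⟩ := key η.hom
    obtain ⟨ψ, hψ⟩ := key η.inv
    have h1 : φ ≫ ψ = 𝟙 X := by
      apply Ext.homEquiv₀.symm.injective
      have h2 := congrArg (fun k => (k.app (op (FGModuleCat.of A X))).hom
        (Ext.mk₀ (𝟙 X) : Ext.{u} X X 0)) η.hom_inv_id
      refine Eq.trans ?_ h2
      refine Eq.trans ?_ (congrArg ((η.inv.app (op (FGModuleCat.of A X))).hom)
        (hφ (FGModuleCat.of A X) (𝟙 X))).symm
      refine Eq.trans ?_ (hψ (FGModuleCat.of A X) _).symm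
      rw [Category.id_comp]; rfl
    have h2 : ψ ≫ φ = 𝟙 X' := by
      apply Ext.homEquiv₀.symm.injective
      have h2 := congrArg (fun k => (k.app (op (FGModuleCat.of A X'))).hom
        (Ext.mk₀ (𝟙 X') : Ext.{u} X' X' 0)) η.inv_hom_id
      refine Eq.trans ?_ h2
      refine Eq.trans ?_ (congrArg ((η.hom.app (op (FGModuleCat.of A X'))).hom)
        (hψ (FGModuleCat.of A X') (𝟙 X'))).symm
      refine Eq.trans ?_ (hφ (FGModuleCat.of A X') _).symm
      rw [Category.id_comp]; rfl
    exact ⟨(Iso.mk φ ψ h1 h2).toLinearEquiv⟩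
  · rintro ⟨e⟩
    exact ⟨extIntoIso 0 e.toModuleIso⟩

/-! ### Injective dimension -/

theorem IsNthCosyzygy.hasInjectiveDimensionLT_iff {n : ℕ} {X N : ModuleCat.{u} A}
    (h : IsNthCosyzygy n X N) :
    HasInjectiveDimensionLT X (n + 1) ↔ Module.Injective A N := by
  induction n generalizing X with
  | zero =>
    obtain ⟨e⟩ := isNthCosyzygy_zero_iff.1 h
    rw [zero_add, ← injective_iff_hasInjectiveDimensionLT_one,
      ← show Module.Injective A X ↔ Injective X from Module.injective_iff_injective_object A X]
    exact ⟨injective_of_equiv e.symm, injective_of_equiv e⟩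
  | succ n ih =>
    obtain ⟨K, hK⟩ := exists_isCosyzygy X
    rw [← ih (h.unshift hK)]
    obtain ⟨E, f, g, hf, hfg, hg⟩ := hK
    obtain ⟨w, hS⟩ := shortExact_of_exact hf.injective hfg hg
    exact (hS.hasInjectiveDimensionLT_X₃_iff n (injective_object hf.injective_module)).symm

end ExtFunctors

end IgusaTodorov

end

noncomputable section

namespace IgusaTodorov

/-! ### The functor Hom(P, -) on modules detected by P. -/

section HomFromProjective

open MulOpposite

variable {Λ : Type u} [Ring Λ] {P : ModuleCat.{u} Λ}

/-! ### The functor `Hom_Λ(P, -)` -/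

namespace homP

/-- The homomorphism underlying an element of `Hom_Λ(P, X)`. -/
def lin {X : ModuleCat.{u} Λ} : homP P X ≃+ (P →ₗ[Λ] X) := ModuleCat.homAddEquiv

theorem lin_op_smul {X : ModuleCat.{u} Λ} (γ : P →ₗ[Λ] P) (f : homP P X) (p : P) :
    lin ((op (ModuleCat.ofHom γ) : EndOp P) • f) p = lin f (γ p) := rfl

theorem ext {X : ModuleCat.{u} Λ} {f g : homP P X} (h : ∀ p, lin f p = lin g p) : f = g :=
  lin.injective (LinearMap.ext h)

variable (P) in
/-- The functor `Hom_Λ(P, -)` on maps. -/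
def map {X Y : ModuleCat.{u} Λ} (g : X →ₗ[Λ] Y) : homP P X →ₗ[EndOp P] homP P Y :=
  ((preadditiveCoyonedaObj P).map (ModuleCat.ofHom g)).hom

theorem lin_map {X Y : ModuleCat.{u} Λ} (g : X →ₗ[Λ] Y) (f : homP P X) (p : P) :
    lin (map P g f) p = g (lin f p) := rfl

theorem map_id (X : ModuleCat.{u} Λ) : map P (LinearMap.id : X →ₗ[Λ] X) = LinearMap.id := rfl

theorem map_comp {X Y Z : ModuleCat.{u} Λ} (g : Y →ₗ[Λ] Z) (f : X →ₗ[Λ] Y) :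
    map P (g ∘ₗ f) = map P g ∘ₗ map P f := rfl

theorem map_sub {X Y : ModuleCat.{u} Λ} (f g : X →ₗ[Λ] Y) :
    map P (f - g) = map P f - map P g := rfl

theorem map_injective {X Y : ModuleCat.{u} Λ} {g : X →ₗ[Λ] Y} (hg : Function.Injective g) :
    Function.Injective (map P g) := fun _ _ h =>
  ext fun p => hg (LinearMap.congr_fun (congrArg lin h) p)

theorem map_surjective [Module.Projective Λ P] {X Y : ModuleCat.{u} Λ} {g : X →ₗ[Λ] Y}
    (hg : Function.Surjective g) : Function.Surjective (map P g) := fun f => by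
  obtain ⟨k, hk⟩ := Module.projective_lifting_property g (lin f) hg
  exact ⟨lin.symm k, ext fun p => LinearMap.congr_fun hk p⟩

theorem map_exact {X Y Z : ModuleCat.{u} Λ} {f : X →ₗ[Λ] Y} {g : Y →ₗ[Λ] Z}
    (hf : Function.Injective f) (hfg : Function.Exact f g) :
    Function.Exact (map P f) (map P g) := by
  intro h
  constructor
  · intro h0
    obtain ⟨k, hk⟩ := exists_lift_ker hf hfg (lin h) (congrArg lin h0)
    exact ⟨lin.symm k, ext fun p => LinearMap.congr_fun hk p⟩
  · rintro ⟨k, rfl⟩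
    exact ext fun p => hfg.apply_apply_eq_zero (lin k p)

/-- `Hom_Λ(P, -)` applied to an isomorphism. -/
def mapEquiv {X Y : ModuleCat.{u} Λ} (e : X ≃ₗ[Λ] Y) : homP P X ≃ₗ[EndOp P] homP P Y :=
  LinearEquiv.ofLinearMap (map P e.toLinearMap) (map P e.symm.toLinearMap)
    (by rw [← map_comp, LinearEquiv.comp_symm, map_id])
    (by rw [← map_comp, LinearEquiv.symm_comp, map_id])

theorem isSummand_map {X M : ModuleCat.{u} Λ} (h : IsSummand X M) :
    IsSummand (homP P X) (homP P M) := by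
  obtain ⟨i, r, h⟩ := isSummand_iff.1 h
  exact isSummand_iff.2 ⟨map P i, map P r, by rw [← map_comp, h, map_id]⟩

/-- `Hom_Λ(P, -)` commutes with finite powers. -/
def piEquiv (n : ℕ) (Y : ModuleCat.{u} Λ) :
    homP P (ModuleCat.of Λ (Fin n → Y)) ≃ₗ[EndOp P] (Fin n → homP P Y) where
  toFun f j := map P (LinearMap.proj j : (Fin n → Y) →ₗ[Λ] Y) f
  invFun g := lin.symm (LinearMap.pi fun j => lin (g j))
  map_add' _ _ := by ext; simp
  map_smul' _ _ := by ext; simp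
  left_inv _ := rfl
  right_inv _ := rfl

theorem inAdd_map {X Y : ModuleCat.{u} Λ} (h : InAdd X Y) : InAdd (homP P X) (homP P Y) := by
  obtain ⟨n, hn⟩ := h
  exact ⟨n, (isSummand_map hn).trans
    (isSummand_of_equiv (N := ModuleCat.of (EndOp P) (Fin n → homP P Y)) (piEquiv n Y))⟩

end homP

open homP

/-! ### Modules detected by `P` -/

variable (P) in
/-- Every nonzero submodule of `J` admits a nonzero homomorphism from `P`. -/
def Detects (J : ModuleCat.{u} Λ) : Prop :=
  ∀ z : J, z ≠ 0 → ∃ (l : P →ₗ[Λ] Λ) (x : P), l x • z ≠ 0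

theorem Detects.of_injective {J K : ModuleCat.{u} Λ} (hJ : Detects P J) (f : K →ₗ[Λ] J)
    (hf : Function.Injective f) : Detects P K := by
  intro z hz
  obtain ⟨l, x, h⟩ := hJ (f z) (by rwa [Ne, map_eq_zero_iff f hf])
  exact ⟨l, x, fun h0 => h (by rw [← _root_.map_smul, h0, _root_.map_zero])⟩

theorem Detects.of_isSummand {J K : ModuleCat.{u} Λ} (hJ : Detects P J) (h : IsSummand K J) :
    Detects P K := by
  obtain ⟨i, r, h⟩ := isSummand_iff.1 h
  exact hJ.of_injective i (Function.LeftInverse.injective (g := r) (LinearMap.congr_fun h))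

theorem Detects.pi {J : ModuleCat.{u} Λ} (hJ : Detects P J) (n : ℕ) :
    Detects P (ModuleCat.of Λ (Fin n → J)) := by
  intro z hz
  obtain ⟨j, hj⟩ := Function.ne_iff.1 hz
  obtain ⟨l, x, h⟩ := hJ (z j) hj
  exact ⟨l, x, fun h0 => h (congrFun h0 j)⟩

theorem Detects.of_inAdd {J K : ModuleCat.{u} Λ} (hJ : Detects P J) (h : InAdd K J) :
    Detects P K := by
  obtain ⟨n, hn⟩ := h
  exact (hJ.pi n).of_isSummand hn

/-- The top is killed by the radical, hence is a module over the semisimple quotient of `Λ` by its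
radical. -/
theorem isSemisimpleModule_top [IsArtinianRing Λ] : IsSemisimpleModule Λ (top P) := by
  have h : Module.IsTorsionBySet Λ (top P) (Ring.jacobson Λ : Set Λ) := by
    rw [Module.isTorsionBySet_quotient_iff]
    exact fun m a ha => Submodule.smul_mem_smul ha trivial
  let _ := h.module
  exact (h.semilinearMap.isSemisimpleModule_iff_of_bijective Function.bijective_id).2 inferInstance

/-- The injective envelope of the top of `P` is detected by `P`. -/
theorem IsInjectiveEnvelope.detects [IsArtinianRing Λ] [Module.Projective Λ P]
    {I : ModuleCat.{u} Λ} {ι : top P →ₗ[Λ] I} (hι : IsInjectiveEnvelope ι) : Detects P I := by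
  intro z hz
  obtain ⟨a, t, hat, ht⟩ := hι.exists_smul hz
  have := isSemisimpleModule_top (P := P)
  obtain ⟨K, hK⟩ := exists_isCompl (Submodule.span Λ {t})
  -- The semisimple top projects onto `Λ t`. Lifting the resulting map `P → Λ t` through `Λ → Λ t`
  -- gives `l` with `l x • t = t`; following `l` by right multiplication by `a` gives a map whose
  -- value at `x` does not kill `z`.
  let q : P →ₗ[Λ] Submodule.span Λ {t} := (Submodule.span Λ {t}).projectionOnto K hK ∘ₗ
    (Ring.jacobson Λ • (⊤ : Submodule Λ P)).mkQ
  obtain ⟨l, hl⟩ := Module.projective_lifting_property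
    (LinearMap.toSpanSingleton Λ (top P) t).rangeRestrict
    ((LinearEquiv.ofEq _ _ (LinearMap.range_toSpanSingleton t).symm).toLinearMap ∘ₗ q)
    (LinearMap.surjective_rangeRestrict _)
  have hl' : ∀ x, l x • t = q x := fun x => congrArg Subtype.val (LinearMap.congr_fun hl x)
  obtain ⟨x, hx⟩ := Submodule.mkQ_surjective _ t
  have hqx : (q x : top P) = t := by
    have : q x = ⟨t, Submodule.mem_span_singleton_self t⟩ := by
      simp only [q, LinearMap.comp_apply, hx]
      exact Submodule.projectionOnto_apply_left hK ⟨t, Submodule.mem_span_singleton_self t⟩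
    rw [this]
  refine ⟨LinearMap.toSpanSingleton Λ Λ a ∘ₗ l, x, ?_⟩
  simp only [LinearMap.comp_apply, LinearMap.toSpanSingleton_apply, smul_eq_mul, mul_smul]
  rwa [hat, ← _root_.map_smul, hl', hqx]

/-- Homomorphisms into a detected module are determined by their image under `Hom_Λ(P, -)`. -/
theorem Detects.eq_of_map_eq {J : ModuleCat.{u} Λ} (hJ : Detects P J) {X : ModuleCat.{u} Λ}
    {f g : X →ₗ[Λ] J} (h : map P f = map P g) : f = g := by
  rw [← sub_eq_zero] at h ⊢
  rw [← homP.map_sub] at h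
  ext x
  by_contra hx
  obtain ⟨l, p, hlp⟩ := hJ _ hx
  apply hlp
  rw [← _root_.map_smul]
  exact LinearMap.congr_fun (congrArg lin (LinearMap.congr_fun h (lin.symm (l.smulRight x)))) p

theorem Detects.subsingleton {J : ModuleCat.{u} Λ} (hJ : Detects P J)
    [Subsingleton (homP P J)] : Subsingleton J := by
  have h : (LinearMap.id : J →ₗ[Λ] J) = 0 :=
    hJ.eq_of_map_eq (LinearMap.ext fun _ => Subsingleton.elim _ _)
  exact ⟨fun x y => (LinearMap.congr_fun h x).trans (LinearMap.congr_fun h y).symm⟩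

/-- Every homomorphism from a submodule of `Hom_Λ(P, X)` to `Hom_Λ(P, J)`, where `J` is an injective
module detected by `P`, is induced by a homomorphism from `X` to `J`. -/
theorem Detects.exists_map_comp_eq {J : ModuleCat.{u} Λ} (hJ : Detects P J)
    (hinj : Module.Injective Λ J) {X : ModuleCat.{u} Λ} {S : Type u} [AddCommGroup S]
    [Module (EndOp P) S] (σ : S →ₗ[EndOp P] homP P X) (hσ : Function.Injective σ)
    (h : S →ₗ[EndOp P] homP P J) : ∃ g : X →ₗ[Λ] J, map P g ∘ₗ σ = h := by
  -- Evaluation maps from a sum of copies of `P` indexed by `S`. If `Ψ` vanishes on the kernel of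
  -- `Φ`, it descends to the image of `Φ` in `X` and extends to `X` by injectivity of `J`.
  let Φ : (S →₀ P) →ₗ[Λ] X := Finsupp.lsum ℕ fun s => lin (σ s)
  let Ψ : (S →₀ P) →ₗ[Λ] J := Finsupp.lsum ℕ fun s => lin (h s)
  have hker : LinearMap.ker Φ ≤ LinearMap.ker Ψ := by
    intro v hv
    by_contra hz
    obtain ⟨l, x, hlx⟩ := hJ (Ψ v) hz
    apply hlx
    -- The endomorphisms `q ↦ l q • p` of `P` collect `v` into one element of `S`, at which `k`
    -- takes the value `q ↦ l q • (evaluation of v)`. As `Φ v = 0`, `σ c = 0` and so `c = 0`,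
    -- contradicting `l x • Ψ v ≠ 0`.
    let c : S := v.sum fun s p => (op (ModuleCat.ofHom (l.smulRight p)) : EndOp P) • s
    have key : ∀ {Z : ModuleCat.{u} Λ} (k : S →ₗ[EndOp P] homP P Z) (q : P),
        lin (k c) q = l q • (Finsupp.lsum ℕ fun s => lin (k s) : (S →₀ P) →ₗ[Λ] Z) v := by
      intro Z k q
      rw [Finsupp.lsum_apply, Finsupp.smul_sum]
      simp only [c, Finsupp.sum]
      rw [map_sum, map_sum, LinearMap.sum_apply]
      refine Finset.sum_congr rfl fun s _ => ?_
      rw [_root_.map_smul, lin_op_smul, LinearMap.smulRight_apply, _root_.map_smul]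
    have hc : c = 0 := by
      apply hσ
      rw [_root_.map_zero]
      refine ext fun q => ?_
      rw [key σ q]
      change l q • Φ v = 0
      rw [show Φ v = 0 from hv, smul_zero]
    have := key h x
    rw [hc, _root_.map_zero, _root_.map_zero] at this
    exact this.symm
  obtain ⟨g, hg⟩ := exists_extend hinj ((LinearMap.ker Φ).liftQ Φ le_rfl)
    (LinearMap.ker_eq_bot.1 (Submodule.ker_liftQ_eq_bot _ _ _ le_rfl))
    ((LinearMap.ker Φ).liftQ Ψ hker)
  refine ⟨g, LinearMap.ext fun s => ext fun p => ?_⟩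
  have h1 := LinearMap.congr_fun hg (Submodule.Quotient.mk (Finsupp.single s p))
  rw [LinearMap.comp_apply, Submodule.liftQ_apply, Submodule.liftQ_apply, Finsupp.lsum_single,
    Finsupp.lsum_single] at h1
  exact h1

/-- `Hom_Λ(P, J)` is injective if `J` is an injective module detected by `P`. -/
theorem Detects.injective_homP {J : ModuleCat.{u} Λ} (hJ : Detects P J)
    (hinj : Module.Injective Λ J) : Module.Injective (EndOp P) (homP P J) := by
  -- A left ideal of `Γ` is a submodule of `Hom(P, P)`, so the extension property applies with `X =
  -- P`.
  refine Module.Baer.injective fun 𝔞 h => ?_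
  let u : homP P P := lin.symm LinearMap.id
  have hu : ∀ (a : EndOp P) p, lin (a • u) p = a.unop.hom p := fun _ _ => rfl
  let σ : 𝔞 →ₗ[EndOp P] homP P P :=
    LinearMap.toSpanSingleton (EndOp P) (homP P P) u ∘ₗ 𝔞.subtype
  have hσ : Function.Injective σ := fun a b hab => by
    apply Subtype.ext
    apply unop_injective
    exact ModuleCat.hom_ext (LinearMap.ext fun p => LinearMap.congr_fun (congrArg lin hab) p)
  obtain ⟨g, hg⟩ := hJ.exists_map_comp_eq hinj σ hσ h
  refine ⟨LinearMap.toSpanSingleton (EndOp P) (homP P J) (map P g u), fun a ha => ?_⟩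
  rw [← hg, LinearMap.toSpanSingleton_apply, ← _root_.map_smul]
  rfl

/-- `Hom_Λ(P, -)` preserves injective envelopes detected by `P`. -/
theorem IsInjectiveEnvelope.map_homP {M E : ModuleCat.{u} Λ} {f : M →ₗ[Λ] E}
    (hf : IsInjectiveEnvelope f) (hE : Detects P E) :
    IsInjectiveEnvelope (E := homP P E) (map P f) := by
  refine .of_exists_smul (hE.injective_homP hf.injective_module) (map_injective hf.injective) ?_
  intro k hk
  obtain ⟨p, hp⟩ : ∃ p, lin k p ≠ 0 := by
    by_contra! h
    exact hk (ext h)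
  obtain ⟨a, m, ham, hm⟩ := hf.exists_smul hp
  obtain ⟨l, x, hlx⟩ := hE _ hm
  -- Precomposing `k` with `q ↦ l q • a • p` gives `q ↦ l q • f m`, which comes from `M` and is
  -- nonzero at `x`.
  refine ⟨op (ModuleCat.ofHom (l.smulRight (a • p))), lin.symm (l.smulRight m), ?_, ?_⟩
  · refine ext fun q => ?_
    rw [lin_op_smul, lin_map]
    change lin k (l q • a • p) = f (l q • m)
    rw [_root_.map_smul, _root_.map_smul, _root_.map_smul, ham]
  · intro h
    apply hlx
    rw [← _root_.map_smul]
    exact LinearMap.congr_fun (congrArg lin h) x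

variable (P) in
/-- `Hom_Λ(P, -)` is fully faithful on homomorphisms into `N`. -/
def FullyFaithfulInto (N : ModuleCat.{u} Λ) : Prop :=
  ∀ X : ModuleCat.{u} Λ, Function.Bijective (map P : (X →ₗ[Λ] N) → _)

/-- A map into `Hom(P, Y)` is induced by some `k : X → J` after composing with `f`. Detection in
`J'` gives `g k = 0`, so `k` factors through the kernel `Y`. -/
theorem FullyFaithfulInto.of_exact {Y J J' : ModuleCat.{u} Λ} (hJ : Detects P J)
    (hinj : Module.Injective Λ J) (hJ' : Detects P J') {f : Y →ₗ[Λ] J} {g : J →ₗ[Λ] J'}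
    (hf : Function.Injective f) (hfg : Function.Exact f g) : FullyFaithfulInto P Y := by
  intro X
  refine ⟨fun a b h => (hJ.of_injective f hf).eq_of_map_eq h, fun h => ?_⟩
  obtain ⟨k, hk⟩ := hJ.exists_map_comp_eq hinj LinearMap.id Function.injective_id (map P f ∘ₗ h)
  rw [LinearMap.comp_id] at hk
  have h0 : g ∘ₗ k = 0 := hJ'.eq_of_map_eq (by
    rw [homP.map_comp, hk, ← LinearMap.comp_assoc, ← homP.map_comp, hfg.linearMap_comp_eq_zero]
    rfl)
  obtain ⟨a, rfl⟩ := exists_lift_ker hf hfg k h0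
  refine ⟨a, LinearMap.ext fun x => map_injective hf ?_⟩
  exact LinearMap.congr_fun hk x

theorem FullyFaithfulInto.of_isSummand {N Y : ModuleCat.{u} Λ} (hY : FullyFaithfulInto P Y)
    (h : IsSummand N Y) : FullyFaithfulInto P N := by
  obtain ⟨i, r, hir⟩ := isSummand_iff.1 h
  intro X
  constructor
  · intro a b hab
    have h1 : i ∘ₗ a = i ∘ₗ b := (hY X).1 (by rw [homP.map_comp, homP.map_comp, hab])
    have h2 := congrArg (r ∘ₗ ·) h1
    simpa only [← LinearMap.comp_assoc, hir, LinearMap.id_comp] using h2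
  · intro k
    obtain ⟨a, ha⟩ := (hY X).2 (map P i ∘ₗ k)
    exact ⟨r ∘ₗ a, by
      rw [homP.map_comp, ha, ← LinearMap.comp_assoc, ← homP.map_comp, hir, homP.map_id,
        LinearMap.id_comp]⟩

end HomFromProjective

end IgusaTodorov

end

noncomputable section

namespace IgusaTodorov

/-! ### Summands of coresolved modules, and finiteness over the endomorphism ring. -/

section Coresolved

open MulOpposite homP

variable {Λ : Type u} [Ring Λ]

/-! ### Modules with a coresolution in `add I` -/

/-- `B` is a direct summand of a module with an injective coresolution in `add I`. -/
def IsCoresolvedSummand (I B : ModuleCat.{u} Λ) : Prop :=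
  ∃ Y : ModuleCat.{u} Λ, HasAddCoresolution I Y ∧ IsSummand B Y

theorem HasAddCoresolution.pi {I Y : ModuleCat.{u} Λ} (h : HasAddCoresolution I Y) (k : ℕ) :
    HasAddCoresolution I (ModuleCat.of Λ (Fin k → Y)) := by
  obtain ⟨J, ε, d, hinj, hadd, hε, hεd, hd⟩ := h
  have exact : ∀ {L M N : ModuleCat.{u} Λ} {f : L →ₗ[Λ] M} {g : M →ₗ[Λ] N},
      Function.Exact f g → Function.Exact (f.compLeft (Fin k)) (g.compLeft (Fin k)) := by
    intro L M N f g hfg x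
    constructor
    · intro hx
      choose y hy using fun j => (hfg (x j)).1 (congrFun hx j)
      exact ⟨y, funext hy⟩
    · rintro ⟨y, rfl⟩
      exact funext fun j => hfg.apply_apply_eq_zero (y j)
  exact ⟨fun n => ModuleCat.of Λ (Fin k → J n), ε.compLeft (Fin k), fun n => (d n).compLeft (Fin k),
    fun n => Module.Injective.pi Λ fun _ : Fin k => J n, fun n => (hadd n).pi k,
    fun x y hxy => funext fun j => hε (congrFun hxy j), exact hεd, fun n => exact (hd n)⟩

theorem HasAddCoresolution.isCoresolvedSummand {I Y B : ModuleCat.{u} Λ}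
    (h : HasAddCoresolution I Y) (hB : InAdd B Y) : IsCoresolvedSummand I B := by
  obtain ⟨n, hn⟩ := hB
  exact ⟨_, h.pi n, hn⟩

theorem IsCoresolvedSummand.of_isSummand {I B C : ModuleCat.{u} Λ} (h : IsCoresolvedSummand I B)
    (hC : IsSummand C B) : IsCoresolvedSummand I C := by
  obtain ⟨Y, hY, hB⟩ := h
  exact ⟨Y, hY, hC.trans hB⟩

/-- The truncated coresolution resolves `ker (d 1)`, which is the cokernel of `ε`; the minimal
cosyzygy of `B` is a summand of it. Allowing summands avoids choosing minimal coresolutions. -/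
theorem IsCoresolvedSummand.cosyzygy {I B N : ModuleCat.{u} Λ} (h : IsCoresolvedSummand I B)
    (hN : IsCosyzygy B N) : IsCoresolvedSummand I N := by
  obtain ⟨Y, ⟨J, ε, d, hinj, hadd, hε, hεd, hd⟩, hB⟩ := h
  have hmem : ∀ x, d 0 x ∈ LinearMap.ker (d 1) := fun x => (hd 0).apply_apply_eq_zero x
  refine ⟨ModuleCat.of Λ (LinearMap.ker (d 1)),
    ⟨fun n => J (n + 1), (LinearMap.ker (d 1)).subtype, fun n => d (n + 1), fun n => hinj _,
      fun n => hadd _, Subtype.val_injective, ?_, fun n => hd _⟩,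
    hN.isSummand_coker hB (hinj 0) (g' := (d 0).codRestrict _ hmem) hε ?_ ?_⟩
  · exact LinearMap.exact_subtype_ker_map (d 1)
  · intro x
    rw [← hεd x]
    exact ⟨fun h => congrArg Subtype.val h, fun h => Subtype.ext h⟩
  · rintro ⟨x, hx⟩
    obtain ⟨y, rfl⟩ := (hd 0 x).1 hx
    exact ⟨y, rfl⟩

theorem IsCoresolvedSummand.nthCosyzygy {n : ℕ} {I B N : ModuleCat.{u} Λ}
    (h : IsCoresolvedSummand I B) (hN : IsNthCosyzygy n B N) : IsCoresolvedSummand I N := by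
  induction n generalizing N with
  | zero =>
    obtain ⟨e⟩ := isNthCosyzygy_zero_iff.1 hN
    exact h.of_isSummand (isSummand_of_equiv e.symm)
  | succ n ih =>
    obtain ⟨K, hK, hN⟩ := hN
    exact (ih hK).cosyzygy hN

variable {P I : ModuleCat.{u} Λ}

theorem IsCoresolvedSummand.fullyFaithfulInto (hI : Detects P I) {B : ModuleCat.{u} Λ}
    (h : IsCoresolvedSummand I B) : FullyFaithfulInto P B := by
  obtain ⟨Y, ⟨J, ε, d, hinj, hadd, hε, hεd, -⟩, hB⟩ := h
  exact (FullyFaithfulInto.of_exact (hI.of_inAdd (hadd 0)) (hinj 0) (hI.of_inAdd (hadd 1)) hε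
    hεd).of_isSummand hB

/-- The embedding of `B` into `J 0` extends to the envelope and stays injective by essentiality. -/
theorem IsCoresolvedSummand.detects_envelope (hI : Detects P I) {B E : ModuleCat.{u} Λ}
    (h : IsCoresolvedSummand I B) {f : B →ₗ[Λ] E} (hf : IsInjectiveEnvelope f) : Detects P E := by
  obtain ⟨Y, ⟨J, ε, d, hinj, hadd, hε, -, -⟩, hB⟩ := h
  obtain ⟨i, r, hir⟩ := isSummand_iff.1 hB
  have hi : Function.Injective i := Function.LeftInverse.injective (g := r) (LinearMap.congr_fun hir)
  obtain ⟨k, hk⟩ := exists_extend (hinj 0) f hf.injective (ε ∘ₗ i)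
  exact (hI.of_inAdd (hadd 0)).of_injective k
    (hf.injective_of_comp k (by rw [hk]; exact hε.comp hi))

theorem IsCoresolvedSummand.detects (hI : Detects P I) {B : ModuleCat.{u} Λ}
    (h : IsCoresolvedSummand I B) : Detects P B := by
  obtain ⟨E, f, hf⟩ := exists_isInjectiveEnvelope B
  exact (h.detects_envelope hI hf).of_injective f hf.injective

theorem IsCosyzygy.map_homP [Module.Projective Λ P] (hI : Detects P I) {B N : ModuleCat.{u} Λ}
    (h : IsCoresolvedSummand I B) (hN : IsCosyzygy B N) :
    IsCosyzygy (homP P B) (homP P N) := by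
  obtain ⟨E, f, g, hf, hfg, hg⟩ := hN
  exact ⟨homP P E, map P f, map P g, hf.map_homP (h.detects_envelope hI hf),
    map_exact hf.injective hfg, map_surjective hg⟩

theorem IsNthCosyzygy.map_homP [Module.Projective Λ P] (hI : Detects P I) {n : ℕ}
    {B N : ModuleCat.{u} Λ} (h : IsCoresolvedSummand I B) (hN : IsNthCosyzygy n B N) :
    IsNthCosyzygy n (homP P B) (homP P N) := by
  induction n generalizing N with
  | zero =>
    obtain ⟨e⟩ := isNthCosyzygy_zero_iff.1 hN
    exact isNthCosyzygy_zero_iff.2 ⟨mapEquiv e⟩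
  | succ n ih =>
    obtain ⟨K, hK, hN⟩ := hN
    exact ⟨_, ih hK, hN.map_homP hI (h.nthCosyzygy hK)⟩

/-- Factoring through an injective means extending along the envelope `ι`. Full faithfulness brings
extensions along `Hom(P, ι)` back to extensions along `ι`; conversely, `Hom(P, E)` is injective. -/
theorem stIso_homP_iff (hI : Detects P I) {M N : ModuleCat.{u} Λ} (hM : IsCoresolvedSummand I M)
    (hN : IsCoresolvedSummand I N) : StIso (homP P M) (homP P N) ↔ StIso M N := by
  have key : ∀ {M N : ModuleCat.{u} Λ} (_ : IsCoresolvedSummand I M)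
      (_ : IsCoresolvedSummand I N) (h : M →ₗ[Λ] N),
      FactorsInjective (map P h) ↔ FactorsInjective h := by
    intro M N hM hN h
    obtain ⟨E, ι, hι⟩ := exists_isInjectiveEnvelope M
    have hE := hM.detects_envelope hI hι
    constructor
    · intro H
      obtain ⟨b, hb⟩ := H.exists_comp (map P ι) (map_injective hι.injective)
      obtain ⟨c, rfl⟩ := (hN.fullyFaithfulInto hI E).2 b
      exact ⟨E, ι, c, hι.injective_module, (hN.fullyFaithfulInto hI M).1 hb⟩
    · intro H
      obtain ⟨b, rfl⟩ := H.exists_comp ι hι.injective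
      exact ⟨homP P E, map P ι, map P b, hE.injective_homP hι.injective_module, rfl⟩
  constructor
  · rintro ⟨f, g, h₁, h₂⟩
    obtain ⟨f, rfl⟩ := (hN.fullyFaithfulInto hI M).2 f
    obtain ⟨g, rfl⟩ := (hM.fullyFaithfulInto hI N).2 g
    exact ⟨f, g, (key hM hM _).1 h₁, (key hN hN _).1 h₂⟩
  · rintro ⟨f, g, h₁, h₂⟩
    exact ⟨map P f, map P g, (key hM hM _).2 h₁, (key hN hN _).2 h₂⟩

theorem nonempty_homP_equiv_iff (hI : Detects P I) {M N : ModuleCat.{u} Λ}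
    (hM : IsCoresolvedSummand I M) (hN : IsCoresolvedSummand I N) :
    Nonempty (homP P M ≃ₗ[EndOp P] homP P N) ↔ Nonempty (M ≃ₗ[Λ] N) := by
  constructor
  · rintro ⟨e⟩
    obtain ⟨f, hf⟩ := (hN.fullyFaithfulInto hI M).2 e.toLinearMap
    obtain ⟨g, hg⟩ := (hM.fullyFaithfulInto hI N).2 e.symm.toLinearMap
    refine ⟨LinearEquiv.ofLinearMap f g ((hN.fullyFaithfulInto hI N).1 ?_)
      ((hM.fullyFaithfulInto hI M).1 ?_)⟩
    · rw [homP.map_comp, hf, hg, LinearEquiv.comp_symm, homP.map_id]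
    · rw [homP.map_comp, hf, hg, LinearEquiv.symm_comp, homP.map_id]
  · rintro ⟨e⟩
    exact ⟨mapEquiv e⟩

/-- Injectivity is vanishing of the cosyzygy, which is itself detected by `P`. -/
theorem injective_homP_iff [Module.Projective Λ P] (hI : Detects P I) {M : ModuleCat.{u} Λ}
    (hM : IsCoresolvedSummand I M) :
    Module.Injective (EndOp P) (homP P M) ↔ Module.Injective Λ M := by
  constructor
  · intro h
    obtain ⟨N, hN⟩ := exists_isCosyzygy M
    have := (hN.map_homP hI hM).subsingleton h
    have := ((hM.cosyzygy hN).detects hI).subsingleton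
    exact hN.injective_of_subsingleton
  · exact (hM.detects hI).injective_homP

/-- Direct summands of `Hom_Λ(P, M)` come from direct summands of `M`. -/
theorem exists_isSummand_homP_equiv (hI : Detects P I) {M : ModuleCat.{u} Λ}
    (hM : IsCoresolvedSummand I M) {Z : ModuleCat.{u} (EndOp P)} (hZ : IsSummand Z (homP P M)) :
    ∃ X : ModuleCat.{u} Λ, IsSummand X M ∧ Nonempty (homP P X ≃ₗ[EndOp P] Z) := by
  obtain ⟨i, r, hir⟩ := isSummand_iff.1 hZ
  -- The idempotent `i ∘ r` lifts to an endomorphism of `M`, idempotent by faithfulness, and its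
  -- image is the wanted summand.
  obtain ⟨e, he⟩ := (hM.fullyFaithfulInto hI M).2 (i ∘ₗ r)
  have hee : e ∘ₗ e = e := (hM.fullyFaithfulInto hI M).1 (by
    rw [homP.map_comp, he]
    exact congrArg (fun k => i ∘ₗ k ∘ₗ r) hir)
  obtain ⟨X, j, q, hjq, hqj⟩ : ∃ (X : ModuleCat.{u} Λ) (j : X →ₗ[Λ] M) (q : M →ₗ[Λ] X),
      j ∘ₗ q = e ∧ q ∘ₗ j = LinearMap.id := by
    refine ⟨ModuleCat.of Λ (LinearMap.range e), (LinearMap.range e).subtype, e.rangeRestrict, rfl,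
      ?_⟩
    apply LinearMap.ext
    rintro ⟨_, x, rfl⟩
    exact Subtype.ext (LinearMap.congr_fun hee x)
  refine ⟨X, isSummand_iff.2 ⟨j, q, hqj⟩,
    ⟨LinearEquiv.ofLinearMap (r ∘ₗ map P j) (map P q ∘ₗ i) ?_ ?_⟩⟩
  · calc (r ∘ₗ map P j) ∘ₗ (map P q ∘ₗ i) = r ∘ₗ map P (j ∘ₗ q) ∘ₗ i := rfl
      _ = (r ∘ₗ i) ∘ₗ (r ∘ₗ i) := by rw [hjq, he]; rfl
      _ = LinearMap.id := by rw [hir, LinearMap.id_comp]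
  · calc (map P q ∘ₗ i) ∘ₗ (r ∘ₗ map P j) = map P q ∘ₗ (i ∘ₗ r) ∘ₗ map P j := rfl
      _ = map P ((q ∘ₗ j) ∘ₗ (q ∘ₗ j)) := by rw [← he, ← hjq]; rfl
      _ = LinearMap.id := by rw [hqj, LinearMap.id_comp, homP.map_id]

theorem exists_inAdd_homP_equiv (hI : Detects P I) {X Y : ModuleCat.{u} Λ}
    (hY : HasAddCoresolution I Y) (hX : InAdd X Y) {Z : ModuleCat.{u} (EndOp P)}
    (hZ : InAdd Z (homP P X)) :
    ∃ W : ModuleCat.{u} Λ, InAdd W X ∧ Nonempty (homP P W ≃ₗ[EndOp P] Z) := by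
  obtain ⟨n, hn⟩ := hZ
  obtain ⟨W, hW, e⟩ := exists_isSummand_homP_equiv hI (hY.isCoresolvedSummand (hX.pi n))
    (hn.trans (isSummand_of_equiv (M := ModuleCat.of (EndOp P) (Fin n → homP P X))
      (piEquiv n X).symm))
  exact ⟨W, ⟨n, hW⟩, e⟩

theorem hasInjectiveDimensionLT_homP_iff [Module.Projective Λ P] (hI : Detects P I)
    {M : ModuleCat.{u} Λ} (hM : IsCoresolvedSummand I M) (n : ℕ) :
    HasInjectiveDimensionLT (homP P M) n ↔ HasInjectiveDimensionLT M n := by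
  cases n with
  | zero =>
    rw [hasInjectiveDimensionLT_zero_iff_isZero, hasInjectiveDimensionLT_zero_iff_isZero,
      ModuleCat.isZero_iff_subsingleton, ModuleCat.isZero_iff_subsingleton]
    constructor
    · intro
      exact (hM.detects hI).subsingleton
    · intro
      exact ⟨fun f g => ext fun p => Subsingleton.elim _ _⟩
  | succ n =>
    obtain ⟨N, hN⟩ := exists_isNthCosyzygy n M
    rw [(hN.map_homP hI hM).hasInjectiveDimensionLT_iff, hN.hasInjectiveDimensionLT_iff,
      injective_homP_iff hI (hM.nthCosyzygy hN)]

theorem injectiveDimension_homP_eq_iff [Module.Projective Λ P] (hI : Detects P I)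
    {M : ModuleCat.{u} Λ} (hM : IsCoresolvedSummand I M) (m : ℕ) :
    injectiveDimension (homP P M) = m ↔ injectiveDimension M = m := by
  simp only [le_antisymm_iff, injectiveDimension_le_iff, injectiveDimension_ge_iff,
    HasInjectiveDimensionLE, hasInjectiveDimensionLT_homP_iff hI hM]

/-! ### Finiteness of `Hom_Λ(P, Y)` -/

/-- A map is determined by its values on finitely many generators, so `Hom(M, N)` embeds into a
finite power of `N`. -/
theorem isNoetherian_linearMap (R : Type*) [CommRing R] [IsNoetherianRing R] [Algebra R Λ]
    [Module.Finite R Λ] (M N : Type u) [AddCommGroup M] [Module Λ M] [Module.Finite Λ M]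
    [AddCommGroup N] [Module Λ N] [Module R N] [IsScalarTower R Λ N] [SMulCommClass Λ R N]
    [Module.Finite Λ N] : IsNoetherian R (M →ₗ[Λ] N) := by
  have : Module.Finite R N := Module.Finite.trans Λ N
  obtain ⟨n, f, hf⟩ := Module.Finite.exists_fin' Λ M
  let ev : (M →ₗ[Λ] N) →ₗ[R] (Fin n → N) :=
    { toFun := fun φ j => φ (f (Pi.single j 1))
      map_add' := fun _ _ => rfl
      map_smul' := fun _ _ => rfl }
  refine isNoetherian_of_injective ev fun φ ψ h => ?_
  have h1 : φ ∘ₗ f = ψ ∘ₗ f := LinearMap.pi_ext' fun j => LinearMap.ext_ring (congrFun h j)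
  ext x
  obtain ⟨y, rfl⟩ := hf x
  exact LinearMap.congr_fun h1 y

/-- `End_Λ(P)ᵒᵖ` is an artin algebra, and `Hom_Λ(P, Y)` is finitely generated over it. -/
theorem hasFiniteEnvelopes_endOp_and_finite (R : Type*) [CommRing R] [IsArtinianRing R]
    [Algebra R Λ] [Module.Finite R Λ] (P Y : ModuleCat.{u} Λ) [Module.Finite Λ P]
    [Module.Finite Λ Y] :
    HasFiniteEnvelopes (EndOp P) ∧ Module.Finite (EndOp P) (homP P Y) := by
  let moduleStr (M : ModuleCat.{u} Λ) : Module R M := Module.compHom M (algebraMap R Λ)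
  have smul_def (M : ModuleCat.{u} Λ) (r : R) (x : M) : r • x = algebraMap R Λ r • x := rfl
  have tower (M : ModuleCat.{u} Λ) : IsScalarTower R Λ M := ⟨fun r a x => by
    rw [Algebra.smul_def, mul_smul]; rfl⟩
  have comm (M : ModuleCat.{u} Λ) : SMulCommClass Λ R M := ⟨fun a r x => by
    rw [smul_def, smul_def, smul_smul, smul_smul, Algebra.commutes]⟩
  let c : R →+* EndOp P :=
    { toFun := fun r => op (ModuleCat.ofHom (r • (LinearMap.id : P →ₗ[Λ] P)))
      map_one' := unop_injective (ModuleCat.hom_ext (one_smul R _))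
      map_zero' := unop_injective (ModuleCat.hom_ext (zero_smul R _))
      map_mul' := fun r s => unop_injective (ModuleCat.hom_ext (LinearMap.ext fun p => by
        change (r * s) • p = s • (r • p)
        rw [mul_comm, mul_smul]))
      map_add' := fun r s => unop_injective (ModuleCat.hom_ext (add_smul r s _)) }
  let : Algebra R (EndOp P) := c.toAlgebra' fun r x => by
    apply unop_injective
    apply ModuleCat.hom_ext
    apply LinearMap.ext
    intro p
    change x.unop.hom (r • p) = r • x.unop.hom p
    rw [smul_def, smul_def, _root_.map_smul]
  have hc : ∀ (r : R) {M : ModuleCat.{u} Λ} (f : homP P M), lin (c r • f) = r • lin f := by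
    intro r M f
    ext p
    change lin f (r • p) = r • lin f p
    rw [smul_def, smul_def, _root_.map_smul]
  let modHom (M : ModuleCat.{u} Λ) : Module R (homP P M) := Module.compHom (homP P M) c
  have finiteHom (M : ModuleCat.{u} Λ) [Module.Finite Λ M] : Module.Finite R (homP P M) := by
    have := isNoetherian_linearMap R P M (Λ := Λ)
    let e : homP P M →ₗ[R] (P →ₗ[Λ] M) :=
      { lin with map_smul' := fun r f => hc r f }
    have := isNoetherian_of_injective e lin.injective
    infer_instance
  have : Module.Finite R (EndOp P) := by
    let e : homP P P →ₗ[R] EndOp P :=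
      { toFun := fun f => op (ModuleCat.ofHom (lin f))
        map_add' := fun _ _ => rfl
        map_smul' := fun _ _ => rfl }
    exact Module.Finite.of_surjective e fun a => ⟨lin.symm a.unop.hom, rfl⟩
  have : IsScalarTower R (EndOp P) (homP P Y) := ⟨fun r a f => by
    rw [Algebra.smul_def, mul_smul]; rfl⟩
  exact ⟨hasFiniteEnvelopes_of_artinAlgebra R _, Module.Finite.of_restrictScalars_finite R _ _⟩

end Coresolved

end IgusaTodorov

end

namespace IgusaTodorov

/-! ### Transfer of injective divisions, φ and ψ between Y and Hom(P, Y). -/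

section Transfer

open homP

variable {Λ : Type u} [Ring Λ] {P I : ModuleCat.{u} Λ}

/-! ### Comparison of `Y` and `Hom_Λ(P, Y)` -/

theorem IsInjectiveDivision.congr {d : ℕ} {M X Y X' Y' : ModuleCat.{u} Λ}
    (h : IsInjectiveDivision d M X Y) (e : X ≃ₗ[Λ] X') (e' : Y ≃ₗ[Λ] Y') :
    IsInjectiveDivision d M X' Y' where
  left_mem := .of_summand (isSummand_of_equiv e.symm) h.left_mem
  right_mem := .of_summand (isSummand_of_equiv e'.symm) h.right_mem
  add_inter Z hZ hZ' := h.add_inter Z (hZ.trans (.of_isSummand (isSummand_of_equiv e.symm)))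
    (hZ'.trans (.of_isSummand (isSummand_of_equiv e'.symm)))
  not_iso := ⟨fun η => h.not_iso.false
    (extIntoIso d e.toModuleIso ≪≫ η ≪≫ (extIntoIso d e'.toModuleIso).symm)⟩
  iso := h.iso.map fun η =>
    (extIntoIso _ e.toModuleIso).symm ≪≫ η ≪≫ extIntoIso _ e'.toModuleIso

variable [Module.Projective Λ P]

theorem cosyzygyReflectsStIso_homP_iff (hI : Detects P I) {Y : ModuleCat.{u} Λ}
    (hY : HasAddCoresolution I Y) (s : ℕ) :
    CosyzygyReflectsStIso s (homP P Y) ↔ CosyzygyReflectsStIso s Y := by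
  constructor
  · intro h B C M N M' N' hB hC hM hN hM' hN' hst
    have cB := hY.isCoresolvedSummand hB
    have cC := hY.isCoresolvedSummand hC
    have cM := cB.nthCosyzygy hM
    have cN := cC.nthCosyzygy hN
    exact (stIso_homP_iff hI cM cN).1 (h (inAdd_map hB) (inAdd_map hC) (hM.map_homP hI cB)
      (hN.map_homP hI cC) (hM'.map_homP hI cM) (hN'.map_homP hI cN)
      ((stIso_homP_iff hI (cM.cosyzygy hM') (cN.cosyzygy hN')).2 hst))
  · intro h B C M N M' N' hB hC hM hN hM' hN' hst
    -- Every module in the additive closure of `Hom(P, Y)` comes from add Y, and uniqueness of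
    -- cosyzygies identifies the given ones with images of cosyzygies over `Λ`.
    obtain ⟨B₀, hB₀, ⟨eB⟩⟩ := exists_inAdd_homP_equiv hI hY (.of_isSummand (.refl Y)) hB
    obtain ⟨C₀, hC₀, ⟨eC⟩⟩ := exists_inAdd_homP_equiv hI hY (.of_isSummand (.refl Y)) hC
    obtain ⟨M₀, hM₀⟩ := exists_isNthCosyzygy s B₀
    obtain ⟨N₀, hN₀⟩ := exists_isNthCosyzygy s C₀
    obtain ⟨M₀', hM₀'⟩ := exists_isCosyzygy M₀
    obtain ⟨N₀', hN₀'⟩ := exists_isCosyzygy N₀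
    have cB := hY.isCoresolvedSummand hB₀
    have cC := hY.isCoresolvedSummand hC₀
    have cM := cB.nthCosyzygy hM₀
    have cN := cC.nthCosyzygy hN₀
    obtain ⟨eM⟩ := (hM₀.map_homP hI cB).unique eB hM
    obtain ⟨eN⟩ := (hN₀.map_homP hI cC).unique eC hN
    obtain ⟨eM'⟩ := (hM₀'.map_homP hI cM).unique eM hM'
    obtain ⟨eN'⟩ := (hN₀'.map_homP hI cN).unique eN hN'
    have h₀ := h hB₀ hC₀ hM₀ hN₀ hM₀' hN₀'
      ((stIso_homP_iff hI (cM.cosyzygy hM₀') (cN.cosyzygy hN₀')).1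
        (((StIso.of_equiv eM').trans hst).trans (.of_equiv eN'.symm)))
    exact ((StIso.of_equiv eM.symm).trans ((stIso_homP_iff hI cM cN).2 h₀)).trans (.of_equiv eN)

variable [HasFiniteEnvelopes Λ] [HasFiniteEnvelopes (EndOp P)] {Y : ModuleCat.{u} Λ}
  [Module.Finite Λ Y] [Module.Finite (EndOp P) (homP P Y)]

/-- The two sets of natural numbers coincide, so their infima agree whether or not they are empty.
-/
theorem phiR_homP_eq (hI : Detects P I) (hY : HasAddCoresolution I Y) :
    phiR (homP P Y) = phiR Y := by
  simp only [phiR_eq_sInf, cosyzygyReflectsStIso_homP_iff hI hY]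

theorem psiR_homP_eq (hI : Detects P I) (hY : HasAddCoresolution I Y) :
    psiR (homP P Y) = psiR Y := by
  have cY : IsCoresolvedSummand I Y := ⟨Y, hY, .refl Y⟩
  rw [psiR, psiR, phiR_homP_eq hI hY]
  congr 2
  ext k
  constructor
  · rintro ⟨m, N, X, hN, hX, hm, rfl⟩
    obtain ⟨N₀, hN₀⟩ := exists_isNthCosyzygy (phiR Y) Y
    have cN := cY.nthCosyzygy hN₀
    obtain ⟨e⟩ := hN.unique (LinearEquiv.refl _ _) (hN₀.map_homP hI cY)
    obtain ⟨X₀, hX₀, ⟨e'⟩⟩ := exists_isSummand_homP_equiv hI cN (hX.trans (isSummand_of_equiv e))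
    refine ⟨m, N₀, X₀, hN₀, hX₀, ?_, rfl⟩
    rw [← injectiveDimension_homP_eq_iff hI (cN.of_isSummand hX₀),
      injectiveDimension_eq_of_iso e'.toModuleIso, hm]
  · rintro ⟨m, N, X, hN, hX, hm, rfl⟩
    exact ⟨m, homP P N, homP P X, hN.map_homP hI cY, isSummand_map hX,
      (injectiveDimension_homP_eq_iff hI ((cY.nthCosyzygy hN).of_isSummand hX) m).2 hm, rfl⟩

theorem nonempty_extInto_homP_iso_iff (hI : Detects P I) (hY : HasAddCoresolution I Y)
    {X X' : ModuleCat.{u} Λ} (hX : InAdd X Y) (hX' : InAdd X' Y) (d : ℕ) :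
    Nonempty (extInto d (homP P X) ≅ extInto d (homP P X')) ↔
      Nonempty (extInto d X ≅ extInto d X') := by
  have := hX.finite
  have := hX'.finite
  have := (inAdd_map (P := P) hX).finite
  have := (inAdd_map (P := P) hX').finite
  have cX := hY.isCoresolvedSummand hX
  have cX' := hY.isCoresolvedSummand hX'
  cases d with
  | zero =>
    rw [nonempty_extInto_zero_iso_iff, nonempty_extInto_zero_iso_iff,
      nonempty_homP_equiv_iff hI cX cX']
  | succ d =>
    obtain ⟨N, hN⟩ := exists_isNthCosyzygy d X
    obtain ⟨N', hN'⟩ := exists_isNthCosyzygy d X'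
    rw [nonempty_extInto_succ_iso_iff (hN.map_homP hI cX) (hN'.map_homP hI cX'),
      nonempty_extInto_succ_iso_iff hN hN', stIso_homP_iff hI (cX.nthCosyzygy hN)
        (cX'.nthCosyzygy hN')]

theorem isInjectiveDivision_homP_iff (hI : Detects P I) (hY : HasAddCoresolution I Y)
    {X X' : ModuleCat.{u} Λ} (hX : InAdd X Y) (hX' : InAdd X' Y) (d : ℕ) :
    IsInjectiveDivision d (homP P Y) (homP P X) (homP P X') ↔ IsInjectiveDivision d Y X X' := by
  constructor
  · intro h
    refine ⟨hX, hX', fun Z hZ hZ' => ?_, ?_,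
      (nonempty_extInto_homP_iso_iff hI hY hX hX' _).1 h.iso⟩
    · have := h.add_inter _ (inAdd_map hZ) (inAdd_map hZ')
      exact ((hY.isCoresolvedSummand (hZ.trans hX)).detects hI).subsingleton
    · rw [← not_nonempty_iff, ← nonempty_extInto_homP_iso_iff hI hY hX hX', not_nonempty_iff]
      exact h.not_iso
  · intro h
    refine ⟨inAdd_map hX, inAdd_map hX', fun Z hZ hZ' => ?_, ?_,
      (nonempty_extInto_homP_iso_iff hI hY hX hX' _).2 h.iso⟩
    · obtain ⟨W, hW, ⟨e⟩⟩ := exists_inAdd_homP_equiv hI hY hX hZ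
      obtain ⟨W', hW', ⟨e'⟩⟩ := exists_inAdd_homP_equiv hI hY hX' hZ'
      obtain ⟨ε⟩ := (nonempty_homP_equiv_iff hI (hY.isCoresolvedSummand (hW.trans hX))
        (hY.isCoresolvedSummand (hW'.trans hX'))).1 ⟨e ≪≫ₗ e'.symm⟩
      have := h.add_inter W hW (.of_summand (isSummand_of_equiv ε) hW')
      have : Subsingleton (homP P W) := ⟨fun f g => ext fun p => Subsingleton.elim _ _⟩
      exact e.symm.toEquiv.subsingleton
    · rw [← not_nonempty_iff, nonempty_extInto_homP_iso_iff hI hY hX hX', not_nonempty_iff]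
      exact h.not_iso

theorem exists_isInjectiveDivision_homP_iff (hI : Detects P I) (hY : HasAddCoresolution I Y)
    (d : ℕ) :
    (∃ Z₁ Z₂ : ModuleCat.{u} (EndOp P), IsInjectiveDivision d (homP P Y) Z₁ Z₂) ↔
      ∃ X₁ X₂ : ModuleCat.{u} Λ, IsInjectiveDivision d Y X₁ X₂ := by
  constructor
  · rintro ⟨Z₁, Z₂, h⟩
    obtain ⟨X₁, hX₁, ⟨e₁⟩⟩ := exists_inAdd_homP_equiv hI hY (.of_isSummand (.refl Y)) h.left_mem
    obtain ⟨X₂, hX₂, ⟨e₂⟩⟩ := exists_inAdd_homP_equiv hI hY (.of_isSummand (.refl Y)) h.right_mem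
    exact ⟨X₁, X₂, (isInjectiveDivision_homP_iff hI hY hX₁ hX₂ d).1 (h.congr e₁.symm e₂.symm)⟩
  · rintro ⟨X₁, X₂, h⟩
    exact ⟨_, _, (isInjectiveDivision_homP_iff hI hY h.left_mem h.right_mem d).2 h⟩

end Transfer

end IgusaTodorov

theorem proposition4p6 {R : Type*} [CommRing R] [IsArtinianRing R]
    {Λ : Type u} [Ring Λ] [Algebra R Λ] [Module.Finite R Λ]
    (P : ModuleCat.{u} Λ) [Module.Finite Λ P] [Module.Projective Λ P]
    (Y : ModuleCat.{u} Λ) [Module.Finite Λ Y] (hY : IgusaTodorov.MemIInfty P Y) :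
    (∀ d : ℕ,
      (∃ X₁ X₂ : ModuleCat.{u} Λ, IgusaTodorov.IsInjectiveDivision d Y X₁ X₂) ↔
      (∃ Z₁ Z₂ : ModuleCat.{u} (IgusaTodorov.EndOp P),
        IgusaTodorov.IsInjectiveDivision d (IgusaTodorov.homP P Y) Z₁ Z₂)) ∧
    IgusaTodorov.phiR Y = IgusaTodorov.phiR (IgusaTodorov.homP P Y) ∧
    IgusaTodorov.psiR Y = IgusaTodorov.psiR (IgusaTodorov.homP P Y) := by
  have := IgusaTodorov.hasFiniteEnvelopes_of_artinAlgebra R Λ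
  obtain ⟨_, _⟩ := IgusaTodorov.hasFiniteEnvelopes_endOp_and_finite R P Y
  obtain ⟨I, ι, hι, hY⟩ := hY
  exact ⟨fun d => (IgusaTodorov.exists_isInjectiveDivision_homP_iff hι.detects hY d).symm,
    (IgusaTodorov.phiR_homP_eq hι.detects hY).symm, (IgusaTodorov.psiR_homP_eq hι.detects hY).symm⟩
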